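/- Let $\mathcal V$ be a polarized rational variation of Hodge structures of weight $3$ with Hodge numbers $h^{3,0}=h^{2,1}=h^{1,2}=h^{0,3}=1$ over a connected open set $B\subseteq\mathbb C$, with trivialized underlying local system $H_{\mathbb Q}\cong\mathbb Q^4$ and polarization given by a symplectic form $Q$ on $H_{\mathbb Q}$. (For example, $\mathcal V$ is the variation of Hodge structures on $H^3$ of the local universal deformation $\mathcal X\to B$ of a Calabi-Yau $3$-manifold $X$ with $h^{2,1}(X)=1$, with $Q$ the cup product; its generic Hodge group is then the group $\mathrm{Hg}(\mathcal X)$.) For $b\in B$ let $h_b:S^1\to \mathrm{GL}(H_{\mathbb R})$ be the representation with $h_b(z)v=z^p\bar z^q v$ for $v\in H^{p,q}_b$, $p+q=3$. The Hodge group at $b$ is the smallest $\mathbb Q$-algebraic subgroup $G\subseteq\mathrm{GL}(H_{\mathbb Q})$ with $h_b(S^1)\subset G_{\mathbb R}$, and the generic Hodge group $\mathrm{Hg}$ is the maximum of the Hodge groups at the points of $B$, that is, the smallest $\mathbb Q$-algebraic subgroup of $\mathrm{GL}(H_{\mathbb Q})$ containing all of them. Let $b\in B$ be any point, and let $\{v_{3,0},v_{2,1},v_{1,2},v_{0,3}\}$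 be a basis of $H_{\mathbb C}$ with $v_{p,q}\in H^{p,q}_b$, $\bar v_{p,q}=v_{q,p}$ and $Q(iv_{3,0},v_{0,3})=Q(-iv_{2,1},v_{1,2})=1$. Assume that the adjoint group $\mathrm{Hg}^{\mathrm{ad}}_{\mathbb R}=\mathrm{Hg}_{\mathbb R}/Z(\mathrm{Hg}_{\mathbb R})$ is isomorphic to $\mathrm{PU}(1,1)$ as an $\mathbb R$-algebraic group and that the center of $\mathrm{Hg}$ is discrete. Then there are $x,y\in\mathbb C$ such that, with respect to this basis, $$\mathrm{Lie}(\mathrm{Hg}_{\mathbb R})=\mathrm{Span}_{\mathbb R}\left(\begin{pmatrix}3i&0&0&0\\0&i&0&0\\0&0&-i&0\\0&0&0&-3i\end{pmatrix},\begin{pmatrix}0&1&0&0\\1&0&x&0\\0&\bar x&0&1\\0&0&1&0\end{pmatrix},\begin{pmatrix}0&i&0&0\\-i&0&y&0\\0&\bar y&0&i\\0&0&-i&0\end{pmatrix}\right),$$ and for all $x,y\in\mathbb C$ for which this equality holds one has $y=ix$ and $|x|=\frac{2}{\sqrt3}$. -/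

import Mathlib

open Complex Matrix
open scoped MatrixGroups

noncomputable section

/-! ### Linear algebraic groups

A linear algebraic group over a subfield `K` of `ℂ` is given by its group of complex points: a
subgroup of `GL n ℂ` cut out by polynomial equations with coefficients in `K`. -/

/-- The subgroup `G` of `GL n ℂ` is the group of complex points of a `K`-algebraic subgroup of
`GL n`, that is, the set of common zeros in `GL n ℂ` of polynomials over `K` in the matrix
entries. -/
def IsAlgebraicOver (K : Type) [Field K] [Algebra K ℂ] {n : ℕ} (G : Subgroup (GL (Fin n) ℂ)) :
    Prop :=
  ∃ S : Set (MvPolynomial (Fin n × Fin n) K), ∀ g : GL (Fin n) ℂ,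
    g ∈ G ↔ ∀ p ∈ S, MvPolynomial.aeval (fun ij : Fin n × Fin n => (g : Matrix _ _ ℂ) ij.1 ij.2) p = 0

/-- An intersection of `K`-algebraic subgroups is a `K`-algebraic subgroup. -/
theorem IsAlgebraicOver.sInf {K : Type} [Field K] [Algebra K ℂ] {n : ℕ}
    {A : Set (Subgroup (GL (Fin n) ℂ))} (hA : ∀ G ∈ A, IsAlgebraicOver K G) :
    IsAlgebraicOver K (sInf A) := by
  choose! S hS using hA
  refine ⟨⋃ G ∈ A, S G, fun g => ?_⟩
  rw [Subgroup.mem_sInf]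
  constructor
  · intro h p hp
    obtain ⟨G, hG, hp⟩ := Set.mem_iUnion₂.1 hp
    exact (hS G hG g).1 (h G hG) p hp
  · intro h G hG
    exact (hS G hG g).2 fun p hp => h p (Set.mem_iUnion₂.2 ⟨G, hG, hp⟩)

/-- Complex conjugation of the entries on `GL n ℂ`. -/
def conjGL {n : ℕ} : GL (Fin n) ℂ →* GL (Fin n) ℂ := Matrix.GeneralLinearGroup.map (starRingEnd ℂ)

/-- The group `G(ℝ)` of real points of `G`. -/
def realPoints {n : ℕ} (G : Subgroup (GL (Fin n) ℂ)) : Subgroup (GL (Fin n) ℂ) where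
  carrier := {g | g ∈ G ∧ conjGL g = g}
  mul_mem' ha hb := ⟨G.mul_mem ha.1 hb.1, by rw [map_mul, ha.2, hb.2]⟩
  one_mem' := ⟨G.one_mem, map_one _⟩
  inv_mem' ha := ⟨G.inv_mem ha.1, by rw [map_inv, ha.2]⟩

/-- The Lie algebra of the Lie group `G(ℝ)`: all matrices `X` whose one-parameter group
`t ↦ exp (t X)`, `t ∈ ℝ`, lies in `G(ℝ)`. (Such an `X` is a real matrix.) -/
def lieAlgebraReal {n : ℕ} (G : Subgroup (GL (Fin n) ℂ)) : Set (Matrix (Fin n) (Fin n) ℂ) :=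
  {X | ∀ t : ℝ, ∃ g ∈ realPoints G, (g : Matrix (Fin n) (Fin n) ℂ) = NormedSpace.exp (t • X)}

/-! ### The real algebraic group `PU(1,1)`

The complex points of `U(1,1)` are `GL 2 ℂ`, with complex conjugation `a ↦ J (a⋆)⁻¹ J⁻¹`,
`J = diag(1,-1)`, whose fixed points are the `a` with `a⋆ J a = J`. The complex points of
`PU(1,1)`, the quotient by the center, are `PGL(2, ℂ)` with the induced conjugation. -/

/-- The hermitian form `diag(1,-1)` of signature `(1,1)`. -/
def hermitianJ : GL (Fin 2) ℂ :=
  Matrix.GeneralLinearGroup.mkOfDetNeZero !![1, 0; 0, -1] (by simp)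

/-- Complex conjugation on `U(1,1)(ℂ) = GL 2 ℂ`. -/
def conjU11 (a : GL (Fin 2) ℂ) : GL (Fin 2) ℂ := hermitianJ * (star a)⁻¹ * hermitianJ⁻¹

/-- A homomorphism `φ` from `G` to `PGL(2, ℂ)` is a morphism of complex algebraic groups: the
functions `a i k * a⁻¹ l j`, which generate the coordinate ring of `PGL 2`, are pulled back to
polynomials in the entries of `g` and `g⁻¹`. -/
def IsRegularToPGL {n : ℕ} {G : Subgroup (GL (Fin n) ℂ)} (φ : G →* PGL(2, ℂ)) : Prop :=
  ∀ i j k l : Fin 2, ∃ p : MvPolynomial ((Fin n × Fin n) ⊕ (Fin n × Fin n)) ℂ,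
    ∀ (g : G) (a : GL (Fin 2) ℂ), Matrix.ProjGenLinGroup.mk a = φ g →
      (a : Matrix (Fin 2) (Fin 2) ℂ) i k * ((a⁻¹ : GL (Fin 2) ℂ) : Matrix (Fin 2) (Fin 2) ℂ) l j =
        MvPolynomial.eval (Sum.elim
          (fun r => ((g : GL (Fin n) ℂ) : Matrix (Fin n) (Fin n) ℂ) r.1 r.2)
          (fun r => (((g : GL (Fin n) ℂ)⁻¹ : GL (Fin n) ℂ) : Matrix (Fin n) (Fin n) ℂ) r.1 r.2)) p

/-- A homomorphism `φ` from `G` to `PU(1,1)(ℂ) = PGL(2, ℂ)` is compatible with the complex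
conjugations, that is, with the real structures of `G` and of `PU(1,1)`. -/
def IsRealToPU11 {n : ℕ} {G : Subgroup (GL (Fin n) ℂ)} (φ : G →* PGL(2, ℂ)) : Prop :=
  ∀ (g g' : G) (a : GL (Fin 2) ℂ), (g' : GL (Fin n) ℂ) = conjGL (g : GL (Fin n) ℂ) →
    Matrix.ProjGenLinGroup.mk a = φ g → Matrix.ProjGenLinGroup.mk (conjU11 a) = φ g'

/-- The adjoint group `G / Z(G)`, as a real algebraic group, is isomorphic to `PU(1,1)`.
(In characteristic zero a bijective morphism of algebraic groups is an isomorphism, and the complex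
points of `G / Z(G)` are the quotient of the group of complex points by its center.) -/
def AdjointGroupIsoPU11 {n : ℕ} (G : Subgroup (GL (Fin n) ℂ)) : Prop :=
  ∃ e : (G ⧸ Subgroup.center G) ≃* PGL(2, ℂ),
    IsRegularToPGL (e.toMonoidHom.comp (QuotientGroup.mk' (Subgroup.center G))) ∧
    IsRealToPU11 (e.toMonoidHom.comp (QuotientGroup.mk' (Subgroup.center G)))

/-! ### Variations of Hodge structures -/

/-- The complex conjugate of a subspace of `ℂ⁴ = ℂ ⊗ ℚ⁴`. -/
def conjSubmodule (W : Submodule ℂ (Fin 4 → ℂ)) : Submodule ℂ (Fin 4 → ℂ) where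
  carrier := {v | star v ∈ W}
  add_mem' {v w} hv hw := by
    rw [Set.mem_ofPred_eq, star_add]; exact W.add_mem hv hw
  zero_mem' := by
    rw [Set.mem_ofPred_eq, star_zero]; exact W.zero_mem
  smul_mem' c v hv := by
    rw [Set.mem_ofPred_eq, star_smul]; exact W.smul_mem _ hv

/-- The complex bilinear extension to `ℂ⁴` of the bilinear form on `ℚ⁴` with Gram matrix `Q`. -/
def bilinC (Q : Matrix (Fin 4) (Fin 4) ℚ) (v w : Fin 4 → ℂ) : ℂ :=
  v ⬝ᵥ (Q.map (fun q : ℚ => (q : ℂ)) *ᵥ w)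

/-- A polarized rational variation of Hodge structures of weight `3` with Hodge numbers
`h^{3,0} = h^{2,1} = h^{1,2} = h^{0,3} = 1` over a connected open set `B ⊆ ℂ`, with a trivialized
local system, identified with `ℚ⁴` by a basis. -/
structure PolarizedVHS where
  /-- the base -/
  B : Set ℂ
  isOpen_B : IsOpen B
  isConnected_B : IsConnected B
  /-- the Gram matrix of the symplectic form -/
  Q : Matrix (Fin 4) (Fin 4) ℚ
  Q_alternating : Qᵀ = -Q
  Q_nondegenerate : Q.det ≠ 0
  /-- the Hodge filtration -/
  F : ℕ → ℂ → Submodule ℂ (Fin 4 → ℂ)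
  F_antitone : ∀ b ∈ B, ∀ p, F (p + 1) b ≤ F p b
  finrank_F : ∀ b ∈ B, ∀ p ≤ 4, Module.finrank ℂ (F p b) = 4 - p
  /-- the filtration at each point defines a Hodge structure of weight `3` -/
  opposed : ∀ b ∈ B, ∀ p q, p + q = 4 → IsCompl (F p b) (conjSubmodule (F q b))
  /-- the filtration varies holomorphically: it has local holomorphic frames -/
  holomorphic : ∀ b ∈ B, ∀ p ≤ 4, ∃ U ⊆ B, IsOpen U ∧ b ∈ U ∧
    ∃ s : Fin (4 - p) → ℂ → (Fin 4 → ℂ), (∀ i, DifferentiableOn ℂ (s i) U) ∧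
      ∀ c ∈ U, F p c = Submodule.span ℂ (Set.range fun i => s i c)
  /-- Griffiths transversality -/
  transversal : ∀ p, ∀ U ⊆ B, IsOpen U → ∀ s : ℂ → (Fin 4 → ℂ), DifferentiableOn ℂ s U →
    (∀ c ∈ U, s c ∈ F (p + 1) c) → ∀ c ∈ U, deriv s c ∈ F p c
  /-- the first Hodge-Riemann bilinear relation -/
  orthogonal : ∀ b ∈ B, ∀ p q, p + q = 4 → ∀ v ∈ F p b, ∀ w ∈ F q b, bilinC Q v w = 0
  /-- the second Hodge-Riemann bilinear relation on `H^{3,0}` -/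
  positive_30 : ∀ b ∈ B, ∀ v ∈ F 3 b, v ≠ 0 → 0 < (I * bilinC Q v (star v)).re
  /-- the second Hodge-Riemann bilinear relation on `H^{2,1}` -/
  positive_21 : ∀ b ∈ B, ∀ v ∈ F 2 b ⊓ conjSubmodule (F 1 b), v ≠ 0 →
    0 < (-I * bilinC Q v (star v)).re

namespace PolarizedVHS

variable (V : PolarizedVHS)

/-- The Hodge component `H^{p,q}` (for `p + q = 3`) at the point `b`. -/
def piece (p q : ℕ) (b : ℂ) : Submodule ℂ (Fin 4 → ℂ) := V.F p b ⊓ conjSubmodule (V.F q b)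

/-- `g = h_b(z)`, where `h_b` is the representation of the circle group attached to the Hodge
structure at `b`: for `p + q = 3`, `g` acts on `H^{p,q}` as multiplication by `z^p * conj z^q`.
By `existsUnique_isHodgeAction` there is exactly one such `g` if `b` is in the base and `|z| = 1`. -/
def IsHodgeAction (b z : ℂ) (g : GL (Fin 4) ℂ) : Prop :=
  ∀ p q : ℕ, p + q = 3 → ∀ v ∈ V.piece p q b,
    (g : Matrix (Fin 4) (Fin 4) ℂ) *ᵥ v = (z ^ p * (starRingEnd ℂ z) ^ q) • v

/-- The Hodge group at `b`: the smallest `ℚ`-algebraic subgroup of `GL 4` that contains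
`h_b(S¹)`. -/
def hodgeGroup (b : ℂ) : Subgroup (GL (Fin 4) ℂ) :=
  sInf {G | IsAlgebraicOver ℚ G ∧ ∀ z : ℂ, ‖z‖ = 1 → ∀ g, V.IsHodgeAction b z g → g ∈ G}

/-- The generic Hodge group: the smallest `ℚ`-algebraic subgroup of `GL 4` that contains the
Hodge groups at all points of the base. It equals the maximum of these Hodge groups,
see `genericHodgeGroup_eq`. -/
def genericHodgeGroup : Subgroup (GL (Fin 4) ℂ) :=
  sInf {G | IsAlgebraicOver ℚ G ∧ ∀ b ∈ V.B, V.hodgeGroup b ≤ G}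

theorem isAlgebraicOver_hodgeGroup (b : ℂ) : IsAlgebraicOver ℚ (V.hodgeGroup b) :=
  IsAlgebraicOver.sInf fun _ hG => hG.1

theorem genericHodgeGroup_eq {G : Subgroup (GL (Fin 4) ℂ)}
    (hG : IsGreatest (V.hodgeGroup '' V.B) G) : V.genericHodgeGroup = G := by
  obtain ⟨⟨b, hb, rfl⟩, h⟩ := hG
  refine le_antisymm (sInf_le ⟨V.isAlgebraicOver_hodgeGroup b, fun c hc => h ⟨c, hc, rfl⟩⟩) ?_
  exact le_sInf fun H hH => hH.2 b hb

/-- A basis `v_{3,0}, v_{2,1}, v_{1,2}, v_{0,3}` of `ℂ⁴` adapted to the Hodge structure at `b`: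
`v_{p,q} ∈ H^{p,q}`, `conj v_{p,q} = v_{q,p}` and
`Q(i v_{3,0}, v_{0,3}) = Q(-i v_{2,1}, v_{1,2}) = 1`. -/
structure IsHodgeBasis (b : ℂ) (v : Module.Basis (Fin 4) ℂ (Fin 4 → ℂ)) : Prop where
  mem_30 : v 0 ∈ V.piece 3 0 b
  mem_21 : v 1 ∈ V.piece 2 1 b
  mem_12 : v 2 ∈ V.piece 1 2 b
  mem_03 : v 3 ∈ V.piece 0 3 b
  conj_30 : star (v 0) = v 3
  conj_21 : star (v 1) = v 2
  norm_30 : bilinC V.Q (I • v 0) (v 3) = 1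
  norm_21 : bilinC V.Q (-I • v 1) (v 2) = 1

/-- The Lie algebra of `Hg_ℝ`, for the generic Hodge group `Hg`, as a set of matrices with respect
to the basis `v` of `ℂ⁴`. -/
def lieHodge (v : Module.Basis (Fin 4) ℂ (Fin 4 → ℂ)) : Set (Matrix (Fin 4) (Fin 4) ℂ) :=
  (fun X => LinearMap.toMatrix v v (Matrix.toLin' X)) '' lieAlgebraReal V.genericHodgeGroup

theorem star_mem_conj {W : Submodule ℂ (Fin 4 → ℂ)} {v : Fin 4 → ℂ} :
    v ∈ conjSubmodule W ↔ star v ∈ W := Iff.rfl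

theorem F_zero {b : ℂ} (hb : b ∈ V.B) : V.F 0 b = ⊤ := by
  apply Submodule.eq_top_of_finrank_eq
  rw [V.finrank_F b hb 0 (by norm_num)]; simp

theorem star_mem_piece {p q : ℕ} {b : ℂ} {w : Fin 4 → ℂ} :
    star w ∈ V.piece q p b ↔ w ∈ V.piece p q b := by
  simp only [piece, Submodule.mem_inf, star_mem_conj, star_star]
  exact and_comm

theorem disj {b : ℂ} (hb : b ∈ V.B) {p q : ℕ} (h : p + q = 4) {w : Fin 4 → ℂ} (h1 : w ∈ V.F p b)
    (h2 : w ∈ conjSubmodule (V.F q b)) : w = 0 :=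
  Submodule.disjoint_def.1 (V.opposed b hb p q h).disjoint w h1 h2

theorem bilinC_I_real (v : Fin 4 → ℂ) :
    (I * bilinC V.Q v (star v)).im = 0 := by
  have h := V.Q_alternating
  have h' : ∀ i j, V.Q j i = - V.Q i j := fun i j => by
    have := congrFun (congrFun h i) j
    simpa using this
  have hd : ∀ i, V.Q i i = 0 := fun i => by have := h' i i; linarith
  simp only [bilinC, dotProduct, mulVec, Fin.sum_univ_four, Matrix.map_apply, hd, h' 0 1, h' 0 2,
    h' 0 3, h' 1 2, h' 1 3, h' 2 3]
  simp
  ring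

theorem exists_isHodgeBasis {b : ℂ} (hb : b ∈ V.B) : ∃ v, V.IsHodgeBasis b v := by
  have f3 := V.finrank_F b hb 3 (by norm_num)
  have f2 := V.finrank_F b hb 2 (by norm_num)
  have c31 := Submodule.finrank_add_eq_of_isCompl (V.opposed b hb 3 1 rfl)
  have norm : ∀ (c : ℂ) (v : Fin 4 → ℂ), c * c = -1 → 0 < (c * bilinC V.Q v (star v)).re → 
      ∃ r : ℝ, r ≠ 0 ∧ bilinC V.Q (c • (r : ℂ) • v) (star ((r : ℂ) • v)) = 1 := by
    intro c v hc hp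
    have him : (c * bilinC V.Q v (star v)).im = 0 := by
      have h0 := V.bilinC_I_real v
      have : c = I ∨ c = -I := by
        have : (c - I) * (c + I) = 0 := by ring_nf; rw [pow_two, hc]; simp
        rcases mul_eq_zero.1 this with h | h
        · left; exact sub_eq_zero.1 h
        · right; exact eq_neg_of_add_eq_zero_left h
      rcases this with rfl | rfl
      · exact h0
      · rw [neg_mul, neg_im, h0, neg_zero]
    set z := c * bilinC V.Q v (star v) with hz
    have hzr : z = (z.re : ℂ) := Complex.ext rfl (by simpa using him)
    refine ⟨(Real.sqrt z.re)⁻¹, inv_ne_zero (Real.sqrt_ne_zero'.2 hp), ?_⟩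
    have : bilinC V.Q (c • (((Real.sqrt z.re)⁻¹ : ℝ) : ℂ) • v)
        (star ((((Real.sqrt z.re)⁻¹ : ℝ) : ℂ) • v)) =
        (((Real.sqrt z.re)⁻¹ : ℝ) : ℂ) * (((Real.sqrt z.re)⁻¹ : ℝ) : ℂ) * z := by
      simp only [bilinC, star_smul, Matrix.mulVec_smul, smul_dotProduct, dotProduct_smul, hz,
        smul_eq_mul]
      simp
      ring
    rw [this, hzr]
    norm_cast
    rw [← mul_inv, Real.mul_self_sqrt hp.le, inv_mul_cancel₀ hp.ne']
  obtain ⟨u0, hu0, hu0n⟩ : ∃ u ∈ V.F 3 b, u ≠ 0 := by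
    apply Submodule.exists_mem_ne_zero_of_ne_bot
    intro h; rw [h] at f3; simp at f3
  obtain ⟨u1, hu1, hu1n⟩ : ∃ u ∈ V.piece 2 1 b, u ≠ 0 := by
    apply Submodule.exists_mem_ne_zero_of_ne_bot
    intro h
    have := Submodule.finrank_sup_add_finrank_inf_eq (V.F 2 b) (conjSubmodule (V.F 1 b))
    have h' : V.F 2 b ⊓ conjSubmodule (V.F 1 b) = ⊥ := h
    rw [h', f2] at this
    have h4 := Submodule.finrank_le (V.F 2 b ⊔ conjSubmodule (V.F 1 b))
    simp at this h4 c31 f3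
    omega
  obtain ⟨r0, hr0, n0⟩ := norm I u0 I_mul_I (V.positive_30 b hb u0 hu0 hu0n)
  obtain ⟨r1, hr1, n1⟩ := norm (-I) u1 (by simp) (V.positive_21 b hb u1 hu1 hu1n)
  set v0 := (r0 : ℂ) • u0
  set v1 := (r1 : ℂ) • u1
  have hv0 : v0 ∈ V.F 3 b := Submodule.smul_mem _ _ hu0
  have hv1 : v1 ∈ V.piece 2 1 b := Submodule.smul_mem _ _ hu1
  have hv0n : v0 ≠ 0 := smul_ne_zero (by exact_mod_cast hr0) hu0n
  have hv1n : v1 ≠ 0 := smul_ne_zero (by exact_mod_cast hr1) hu1n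
  have key : ∀ a c : ℂ, a • v0 + c • v1 = 0 → a = 0 ∧ c = 0 := by
    intro a c h
    have h0 : a • v0 = 0 := by
      refine V.disj hb (p := 3) (q := 1) rfl (Submodule.smul_mem _ _ hv0) ?_
      rw [eq_neg_of_add_eq_zero_left h]
      exact Submodule.neg_mem _ (Submodule.smul_mem _ _ hv1.2)
    rw [h0, zero_add] at h
    exact ⟨(smul_eq_zero.1 h0).resolve_right hv0n, (smul_eq_zero.1 h).resolve_right hv1n⟩
  have in2 : ∀ a c : ℂ, a • v0 + c • v1 ∈ V.F 2 b := fun a c =>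
    Submodule.add_mem _ (Submodule.smul_mem _ _ (V.F_antitone b hb 2 hv0))
      (Submodule.smul_mem _ _ hv1.1)
  have li : LinearIndependent ℂ ![v0, v1, star v1, star v0] := by
    rw [Fintype.linearIndependent_iff]
    intro g hg
    simp only [Fin.sum_univ_four] at hg
    simp at hg
    have hs : star (g 2 • star v1 + g 3 • star v0) = star (g 3) • v0 + star (g 2) • v1 := by
      simp [star_smul, add_comm]
    have e : g 0 • v0 + g 1 • v1 = 0 := by
      refine V.disj hb (p := 2) (q := 2) rfl (in2 _ _) ?_
      have : g 0 • v0 + g 1 • v1 = - (g 2 • star v1 + g 3 • star v0) := by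
        rw [eq_neg_iff_add_eq_zero, ← hg]; abel
      rw [this]
      refine Submodule.neg_mem _ ?_
      rw [star_mem_conj, hs]
      exact in2 _ _
    have e' : star (g 3) • v0 + star (g 2) • v1 = 0 := by
      rw [← hs]
      have : g 2 • star v1 + g 3 • star v0 = 0 := by
        have h2 : (g 0 • v0 + g 1 • v1) + (g 2 • star v1 + g 3 • star v0) = 0 := by
          rw [← hg]; abel
        rwa [e, zero_add] at h2
      rw [this, star_zero]
    obtain ⟨h0, h1⟩ := key _ _ e
    obtain ⟨h3, h2⟩ := key _ _ e'
    intro i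
    fin_cases i
    · exact h0
    · exact h1
    · exact star_eq_zero.1 h2
    · exact star_eq_zero.1 h3
  refine ⟨basisOfLinearIndependentOfCardEqFinrank li (by simp), ?_⟩
  have p0 : v0 ∈ V.piece 3 0 b := ⟨hv0, by
    change star v0 ∈ V.F 0 b
    rw [V.F_zero hb]
    trivial⟩
  constructor
  · simpa using p0
  · simpa using hv1
  · simpa using V.star_mem_piece.2 hv1
  · simpa using V.star_mem_piece.2 p0
  · simp
  · simp
  · simpa using n0
  · simpa using n1

/-- For `b` in the base and `|z| = 1` there is exactly one `h_b(z)`. -/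
theorem existsUnique_isHodgeAction {b : ℂ} (hb : b ∈ V.B) {z : ℂ} (hz : ‖z‖ = 1) :
    ∃! g, V.IsHodgeAction b z g := by
  obtain ⟨v, hv⟩ := V.exists_isHodgeBasis hb
  have hz0 : z ≠ 0 := by rintro rfl; simp at hz
  have hzc : starRingEnd ℂ z ≠ 0 := by simpa using hz0
  set d : Fin 4 → ℂ := ![z ^ 3, z ^ 2 * starRingEnd ℂ z, z * (starRingEnd ℂ z) ^ 2,
    (starRingEnd ℂ z) ^ 3] with hd
  have p30 : ∀ w ∈ V.piece 3 0 b, ∃ c : ℂ, w = c • v 0 := by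
    intro w hw
    have hsum := v.sum_repr w
    rw [Fin.sum_univ_four] at hsum
    set c := v.repr w
    have m0 := V.F_antitone b hb 2 hv.mem_30.1
    have e : w - (c 0 • v 0 + c 1 • v 1) = 0 := by
      refine V.disj hb (p := 2) (q := 2) rfl ?_ ?_
      · exact Submodule.sub_mem _ (V.F_antitone b hb 2 hw.1) (Submodule.add_mem _
          (Submodule.smul_mem _ _ m0) (Submodule.smul_mem _ _ hv.mem_21.1))
      · have : w - (c 0 • v 0 + c 1 • v 1) = c 2 • v 2 + c 3 • v 3 := by
          rw [← hsum]; abel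
        rw [this, ← hv.conj_21, ← hv.conj_30]
        refine Submodule.add_mem _ (Submodule.smul_mem _ _ ?_) (Submodule.smul_mem _ _ ?_)
        · rw [star_mem_conj, star_star]; exact hv.mem_21.1
        · rw [star_mem_conj, star_star]; exact m0
    refine ⟨c 0, ?_⟩
    have e1 : w - c 0 • v 0 = 0 := by
      refine V.disj hb (p := 3) (q := 1) rfl
        (Submodule.sub_mem _ hw.1 (Submodule.smul_mem _ _ hv.mem_30.1)) ?_
      have : w - c 0 • v 0 = c 1 • v 1 := by
        rw [sub_eq_zero.1 e]; abel
      rw [this]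
      exact Submodule.smul_mem _ _ hv.mem_21.2
    exact sub_eq_zero.1 e1
  have p21 : ∀ w ∈ V.piece 2 1 b, ∃ c : ℂ, w = c • v 1 := by
    intro w hw
    have hsum := v.sum_repr w
    rw [Fin.sum_univ_four] at hsum
    set c := v.repr w
    have m0 := V.F_antitone b hb 2 hv.mem_30.1
    have e : w - (c 0 • v 0 + c 1 • v 1) = 0 := by
      refine V.disj hb (p := 2) (q := 2) rfl ?_ ?_
      · exact Submodule.sub_mem _ hw.1 (Submodule.add_mem _
          (Submodule.smul_mem _ _ m0) (Submodule.smul_mem _ _ hv.mem_21.1))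
      · have : w - (c 0 • v 0 + c 1 • v 1) = c 2 • v 2 + c 3 • v 3 := by
          rw [← hsum]; abel
        rw [this, ← hv.conj_21, ← hv.conj_30]
        refine Submodule.add_mem _ (Submodule.smul_mem _ _ ?_) (Submodule.smul_mem _ _ ?_)
        · rw [star_mem_conj, star_star]; exact hv.mem_21.1
        · rw [star_mem_conj, star_star]; exact m0
    refine ⟨c 1, ?_⟩
    have e1 : c 0 • v 0 = 0 := by
      refine V.disj hb (p := 3) (q := 1) rfl (Submodule.smul_mem _ _ hv.mem_30.1) ?_
      have : c 0 • v 0 = w - c 1 • v 1 := by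
        rw [sub_eq_zero.1 e]; abel
      rw [this]
      exact Submodule.sub_mem _ hw.2 (Submodule.smul_mem _ _ hv.mem_21.2)
    rw [sub_eq_zero.1 e, e1, zero_add]
  have p12 : ∀ w ∈ V.piece 1 2 b, ∃ c : ℂ, w = c • v 2 := by
    intro w hw
    obtain ⟨c, hc⟩ := p21 _ (V.star_mem_piece.2 hw)
    exact ⟨star c, by rw [← star_star w, hc, star_smul, hv.conj_21]⟩
  have p03 : ∀ w ∈ V.piece 0 3 b, ∃ c : ℂ, w = c • v 3 := by
    intro w hw
    obtain ⟨c, hc⟩ := p30 _ (V.star_mem_piece.2 hw)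
    exact ⟨star c, by rw [← star_star w, hc, star_smul, hv.conj_30]⟩
  have equiv : ∀ g : GL (Fin 4) ℂ, V.IsHodgeAction b z g ↔
      ∀ i, (g : Matrix (Fin 4) (Fin 4) ℂ) *ᵥ v i = d i • v i := by
    intro g
    constructor
    · intro h i
      fin_cases i
      · simpa [hd] using h 3 0 rfl _ hv.mem_30
      · simpa [hd] using h 2 1 rfl _ hv.mem_21
      · simpa [hd] using h 1 2 rfl _ hv.mem_12
      · simpa [hd] using h 0 3 rfl _ hv.mem_03
    · intro h p q hpq w hw
      obtain ⟨rfl, rfl⟩ | ⟨rfl, rfl⟩ | ⟨rfl, rfl⟩ | ⟨rfl, rfl⟩ :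
          (p = 3 ∧ q = 0) ∨ (p = 2 ∧ q = 1) ∨ (p = 1 ∧ q = 2) ∨ (p = 0 ∧ q = 3) := by omega
      · obtain ⟨c, rfl⟩ := p30 w hw
        rw [Matrix.mulVec_smul, h 0, smul_comm]; simp [hd]
      · obtain ⟨c, rfl⟩ := p21 w hw
        rw [Matrix.mulVec_smul, h 1, smul_comm]; simp [hd]
      · obtain ⟨c, rfl⟩ := p12 w hw
        rw [Matrix.mulVec_smul, h 2, smul_comm]; simp [hd]
      · obtain ⟨c, rfl⟩ := p03 w hw
        rw [Matrix.mulVec_smul, h 3, smul_comm]; simp [hd]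
  have hd0 : ∀ i, d i ≠ 0 := by
    intro i; fin_cases i <;> simp [hd, hz0]
  set M : (Fin 4 → ℂ) → Matrix (Fin 4) (Fin 4) ℂ := fun e =>
    LinearMap.toMatrix' (Matrix.toLin v v (Matrix.diagonal e)) with hM
  have hMv : ∀ e i, M e *ᵥ v i = e i • v i := by
    intro e i
    rw [← Matrix.toLin'_apply, hM, Matrix.toLin'_toMatrix', Matrix.toLin_self]
    simp [Matrix.diagonal_apply]
  have inj : ∀ A C : Matrix (Fin 4) (Fin 4) ℂ, (∀ i, A *ᵥ v i = C *ᵥ v i) → A = C := by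
    intro A C h
    apply Matrix.toLin'.injective
    exact v.ext fun i => by simpa using h i
  have hMM : ∀ e f : Fin 4 → ℂ, (∀ i, e i * f i = 1) → M e * M f = 1 := by
    intro e f h
    apply inj
    intro i
    rw [← Matrix.mulVec_mulVec, hMv, Matrix.mulVec_smul, hMv, smul_smul, mul_comm, h]
    simp
  refine ⟨⟨M d, M d⁻¹, hMM _ _ fun i => mul_inv_cancel₀ (hd0 i),
    hMM _ _ fun i => inv_mul_cancel₀ (hd0 i)⟩, (equiv _).2 fun i => hMv d i, ?_⟩
  intro g hg
  apply Units.ext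
  apply inj
  intro i
  rw [(equiv g).1 hg i]
  exact (hMv d i).symm

end PolarizedVHS

/-- The real span of `diag(3i, i, -i, -3i)` and of the two matrices depending on `x` and `y`. -/
def spanXY (x y : ℂ) : Submodule ℝ (Matrix (Fin 4) (Fin 4) ℂ) :=
  Submodule.span ℝ
    {!![3 * I, 0, 0, 0;
        0, I, 0, 0;
        0, 0, -I, 0;
        0, 0, 0, -3 * I],
     !![0, 1, 0, 0;
        1, 0, x, 0;
        0, starRingEnd ℂ x, 0, 1;
        0, 0, 1, 0],
     !![0, I, 0, 0;
        -I, 0, y, 0;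
        0, starRingEnd ℂ y, 0, I;
        0, 0, -I, 0]}

end

/-! Let `G` be the generic Hodge group and `W` its complex Lie algebra, written in the Hodge basis.
Four facts about `W` carry the proof. Since the center is discrete and `G / Z(G)` is `PGL(2, ℂ)`,
the map from `G` to `PGL(2, ℂ)` has injective differential, so `dim W ≤ 3`
(`finrank_lieSubmodule_le`). Differentiating `h_b` on the circle puts `H = diag(3, 1, -1, -3)` in
`W` (`IsHodgeBasis.weightMatrix_mem`). As `G` is defined over `ℚ`, `W` is stable under complex
conjugation, which in this basis is `conjRev`. As every `h_b(z)` preserves `Q`, `W` is contained in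
the symplectic Lie algebra.

Bracketing with `H` grades matrices by the weight `j - i` of the entry `(i, j)`, and conjugation
negates weights. `W` cannot consist of diagonal matrices: `H` would commute with all its conjugates
under `G`, which is impossible for a non-trivial one-parameter group of `PGL(2, ℂ)`
(`eq_zero_of_commute_conj`). So `W` contains some `E ≠ 0` of weight `m > 0`, and it is spanned by
`H`, `E` and its conjugate `E'`. Now `[E, E']` has weight `0`, so it is a multiple of `H`. Comparing
its first two diagonal entries, which must be in ratio `3 : 1`, excludes `m = 2` and `m = 3`. For `m
= 1` the symplectic condition gives `E` the superdiagonal `(a, c, a)`, and the ratio gives `3(|c|² -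
|a|²) = |a|²`, that is, `|c / a|² = 4/3` (`exists_raisingMatrix_mem`). The real Lie algebra is the
set of fixed points of the conjugation, which is `spanXY x (I * x)` with `x = c / a`; the entries of
that space determine `x` and `y`. -/

section

open scoped Matrix.Norms.Operator

/-! ### The Lie product formula -/

section LieProduct

open Filter Topology

variable {A : Type*} [NormedRing A] [NormOneClass A] [NormedAlgebra ℂ A]

theorem norm_pow_sub_pow_le {A : Type*} [NormedRing A] [NormOneClass A] {a b : A} {M : ℝ}
    (ha : ‖a‖ ≤ M) (hb : ‖b‖ ≤ M) (n : ℕ) :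
    ‖a ^ (n + 1) - b ^ (n + 1)‖ ≤ (n + 1) * M ^ n * ‖a - b‖ := by
  have hM : 0 ≤ M := (norm_nonneg a).trans ha
  induction n with
  | zero => simp
  | succ n ih =>
    have e : a ^ (n + 2) - b ^ (n + 2) =
        a * (a ^ (n + 1) - b ^ (n + 1)) + (a - b) * b ^ (n + 1) := by
      rw [pow_succ' a (n + 1), pow_succ' b (n + 1)]; noncomm_ring
    rw [e]
    have h1 : ‖b ^ (n + 1)‖ ≤ M ^ (n + 1) :=
      (norm_pow_le b _).trans (pow_le_pow_left₀ (norm_nonneg b) hb _)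
    calc _ ≤ ‖a‖ * ‖a ^ (n + 1) - b ^ (n + 1)‖ + ‖a - b‖ * ‖b ^ (n + 1)‖ :=
          (norm_add_le _ _).trans (add_le_add (norm_mul_le _ _) (norm_mul_le _ _))
      _ ≤ M * ((n + 1) * M ^ n * ‖a - b‖) + ‖a - b‖ * M ^ (n + 1) := by gcongr
      _ = _ := by push_cast; ring

theorem norm_normedSpace_exp_le (x : A) : ‖NormedSpace.exp x‖ ≤ Real.exp ‖x‖ := by
  have h1 : Summable fun n : ℕ => ‖((n.factorial : ℂ)⁻¹) • x ^ n‖ :=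
    NormedSpace.norm_expSeries_summable' x
  have h2 : Summable fun n : ℕ => ((n.factorial : ℝ)⁻¹) • ‖x‖ ^ n :=
    NormedSpace.expSeries_summable' ‖x‖
  rw [NormedSpace.exp_eq_tsum ℂ, Real.exp_eq_exp_ℝ, NormedSpace.exp_eq_tsum ℝ]
  refine (norm_tsum_le_tsum_norm h1).trans (h1.tsum_le_tsum (fun n => ?_) h2)
  rw [norm_smul, norm_inv, Complex.norm_natCast, smul_eq_mul]
  exact mul_le_mul_of_nonneg_left (norm_pow_le x n) (by positivity)

/-- The Lie product formula. -/
theorem tendsto_exp_mul_exp_pow [CompleteSpace A] (x y : A) :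
    Tendsto (fun n : ℕ => (NormedSpace.exp (((n + 1 : ℂ)⁻¹) • x) *
      NormedSpace.exp (((n + 1 : ℂ)⁻¹) • y)) ^ (n + 1)) atTop (𝓝 (NormedSpace.exp (x + y))) := by
  let _ : NormedAlgebra ℚ A := NormedAlgebra.restrictScalars ℚ ℂ A
  -- The two factors to be compared agree to first order at `s = 0`, so `(n + 1) * ‖f (1 / (n +
  -- 1))‖` tends to `0`.
  set f : ℂ → A := fun s => NormedSpace.exp (s • x) * NormedSpace.exp (s • y) -
    NormedSpace.exp (s • (x + y)) with hf
  have hd : HasDerivAt f 0 0 := by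
    have h1 := hasDerivAt_exp_smul_const (𝕂 := ℂ) x 0
    have h2 := hasDerivAt_exp_smul_const (𝕂 := ℂ) y 0
    have h3 := hasDerivAt_exp_smul_const (𝕂 := ℂ) (x + y) 0
    have h4 : HasDerivAt f _ 0 := (h1.mul h2).sub h3
    refine h4.congr_deriv ?_
    rw [zero_smul, zero_smul, zero_smul, NormedSpace.exp_zero]
    noncomm_ring
  have hs : Tendsto (fun n : ℕ => ((n + 1 : ℂ)⁻¹)) atTop (𝓝[≠] 0) := by
    rw [tendsto_nhdsWithin_iff]
    refine ⟨?_, Eventually.of_forall fun n => ?_⟩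
    · have := tendsto_one_div_add_atTop_nhds_zero_nat (𝕜 := ℂ)
      simpa using this
    · exact inv_ne_zero (by exact_mod_cast n.succ_ne_zero)
  have hlim := ((hasDerivAt_iff_tendsto_slope_zero.1 hd).comp hs).norm
  have f0 : f 0 = 0 := by simp [hf]
  rw [tendsto_iff_norm_sub_tendsto_zero]
  set K := Real.exp (‖x‖ + ‖y‖)
  refine squeeze_zero (g := fun n : ℕ => K * ((n + 1) * ‖f ((n + 1 : ℂ)⁻¹)‖)) (fun _ => norm_nonneg _) ?_ ?_
  · intro n
    have hn : (0 : ℝ) < n + 1 := by positivity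
    have hnn : ‖((n + 1 : ℂ)⁻¹)‖ = ((n : ℝ) + 1)⁻¹ := by
      rw [norm_inv]; congr 1; exact_mod_cast Complex.norm_natCast (n + 1)
    set s := ((n + 1 : ℂ)⁻¹)
    have e : NormedSpace.exp (x + y) = NormedSpace.exp (s • (x + y)) ^ (n + 1) := by
      rw [← NormedSpace.exp_nsmul, ← Nat.cast_smul_eq_nsmul ℂ, smul_smul]
      have : ((n + 1 : ℕ) : ℂ) * s = 1 := by
        push_cast
        exact mul_inv_cancel₀ (by exact_mod_cast n.succ_ne_zero)
      rw [this, one_smul]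
    rw [e]
    -- `M` bounds both factors, and `M ^ n ≤ K` uniformly in `n`, so taking powers multiplies the
    -- error by at most `K * (n + 1)`.
    set M := Real.exp ((‖x‖ + ‖y‖) / (n + 1))
    have ha : ‖NormedSpace.exp (s • x) * NormedSpace.exp (s • y)‖ ≤ M := by
      refine (norm_mul_le _ _).trans ?_
      refine (mul_le_mul (norm_normedSpace_exp_le _) (norm_normedSpace_exp_le _) (norm_nonneg _) (Real.exp_nonneg _)).trans ?_
      rw [← Real.exp_add, norm_smul, norm_smul, hnn]
      apply le_of_eq; congr 1; field_simp
    have hb : ‖NormedSpace.exp (s • (x + y))‖ ≤ M := by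
      refine (norm_normedSpace_exp_le _).trans (Real.exp_le_exp.2 ?_)
      rw [norm_smul, hnn, inv_mul_eq_div]
      gcongr
      exact norm_add_le _ _
    refine (norm_pow_sub_pow_le ha hb n).trans ?_
    have hMn : M ^ n ≤ K := by
      rw [← Real.exp_nat_mul]
      apply Real.exp_le_exp.2
      rw [mul_div_assoc', div_le_iff₀ hn]
      nlinarith [norm_nonneg x, norm_nonneg y]
    have : ‖NormedSpace.exp (s • x) * NormedSpace.exp (s • y) - NormedSpace.exp (s • (x + y))‖ = ‖f s‖ := rfl
    rw [this]
    calc _ ≤ (n + 1) * K * ‖f s‖ := by gcongr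
      _ = _ := by ring
  · have : Tendsto (fun n : ℕ => K * ((n + 1) * ‖f ((n + 1 : ℂ)⁻¹)‖)) atTop (𝓝 (K * ‖(0 : A)‖)) := by
      refine Tendsto.const_mul _ ?_
      refine hlim.congr fun n => ?_
      simp only [Function.comp, zero_add, f0, sub_zero, inv_inv]
      rw [norm_smul]
      congr 1
      exact_mod_cast Complex.norm_natCast (n + 1)
    simpa using this

end LieProduct

/-! ### The Lie algebra of a linear algebraic group -/

section OneParameter

variable {n : ℕ}

/-- The exponential of a matrix, as an invertible matrix. -/
noncomputable def expGL (X : Matrix (Fin n) (Fin n) ℂ) : GL (Fin n) ℂ where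
  val := NormedSpace.exp X
  inv := NormedSpace.exp (-X)
  val_inv := by
    rw [← Matrix.exp_add_of_commute _ _ (Commute.refl X).neg_right, add_neg_cancel,
      NormedSpace.exp_zero]
  inv_val := by
    rw [← Matrix.exp_add_of_commute _ _ (Commute.refl X).neg_left, neg_add_cancel,
      NormedSpace.exp_zero]

theorem coe_expGL (X : Matrix (Fin n) (Fin n) ℂ) :
    (expGL X : Matrix (Fin n) (Fin n) ℂ) = NormedSpace.exp X := rfl

theorem coe_expGL_inv (X : Matrix (Fin n) (Fin n) ℂ) :
    ((expGL X)⁻¹ : GL (Fin n) ℂ).val = NormedSpace.exp (-X) := rfl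

theorem expGL_add {X Y : Matrix (Fin n) (Fin n) ℂ} (h : Commute X Y) :
    expGL (X + Y) = expGL X * expGL Y :=
  Units.ext (Matrix.exp_add_of_commute X Y h)

theorem expGL_zero : expGL (0 : Matrix (Fin n) (Fin n) ℂ) = 1 := Units.ext NormedSpace.exp_zero

theorem expGL_units_conj (g : GL (Fin n) ℂ) (X : Matrix (Fin n) (Fin n) ℂ) :
    expGL ((g : Matrix (Fin n) (Fin n) ℂ) * X * ((g⁻¹ : GL (Fin n) ℂ) : Matrix (Fin n) (Fin n) ℂ)) =
      g * expGL X * g⁻¹ :=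
  Units.ext (by simpa [coe_expGL] using Matrix.exp_units_conj g X)

theorem conjGL_expGL (X : Matrix (Fin n) (Fin n) ℂ) :
    conjGL (expGL X) = expGL (X.map (starRingEnd ℂ)) := by
  apply Units.ext
  have h : ∀ Y : Matrix (Fin n) (Fin n) ℂ, Y.map (starRingEnd ℂ) = Yᴴᵀ := fun Y => by
    ext i j; simp
  rw [coe_expGL, h, Matrix.exp_transpose, Matrix.exp_conjTranspose, ← h]
  rfl

theorem continuous_expGL_smul (X : Matrix (Fin n) (Fin n) ℂ) :
    Continuous fun z : ℂ => expGL (z • X) := by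
  rw [Units.continuous_iff]
  constructor
  · exact (NormedSpace.exp_continuous).comp (continuous_id.smul continuous_const)
  · exact (NormedSpace.exp_continuous).comp (continuous_id.smul continuous_const).neg

theorem eq_zero_of_expGL_smul_eq_one {X : Matrix (Fin n) (Fin n) ℂ}
    (h : ∀ z : ℂ, expGL (z • X) = 1) : X = 0 := by
  have h1 : HasDerivAt (fun z : ℂ => NormedSpace.exp (z • X)) _ 0 :=
    hasDerivAt_exp_smul_const (𝕂 := ℂ) X 0
  have h2 : (fun z : ℂ => NormedSpace.exp (z • X)) = fun _ => 1 := by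
    funext z; rw [← coe_expGL, h]; rfl
  rw [h2] at h1
  have := h1.unique (hasDerivAt_const _ _)
  simpa using this

/-- The complex Lie algebra of a group of matrices. -/
def lieAlgebraSet (G : Subgroup (GL (Fin n) ℂ)) : Set (Matrix (Fin n) (Fin n) ℂ) :=
  {X | ∀ z : ℂ, expGL (z • X) ∈ G}

variable {K : Type} [Field K] [Algebra K ℂ] {G : Subgroup (GL (Fin n) ℂ)}

theorem differentiable_aeval_exp (p : MvPolynomial (Fin n × Fin n) K)
    (X : Matrix (Fin n) (Fin n) ℂ) : Differentiable ℂ fun z : ℂ =>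
      MvPolynomial.aeval (fun ij : Fin n × Fin n =>
        (expGL (z • X) : Matrix (Fin n) (Fin n) ℂ) ij.1 ij.2) p := by
  have hX : Differentiable ℂ fun z : ℂ => NormedSpace.exp (z • X) :=
    differentiable_exp_smul_const (𝕂 := ℂ) X
  have hij : ∀ i j, Differentiable ℂ fun z : ℂ => NormedSpace.exp (z • X) i j := fun i j =>
    ((Matrix.entryLinearMap ℂ ℂ i j).toContinuousLinearMap.differentiable).comp hX
  induction p using MvPolynomial.induction_on with
  | C a => simp
  | add p q hp hq => simpa using! hp.add hq
  | mul_X p i hp => simpa [coe_expGL] using! hp.mul (hij i.1 i.2)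

/-- A defining polynomial evaluated at `exp (z X)` is an entire function of `z`. It vanishes for
real `z`, hence everywhere by the identity theorem. -/
theorem mem_lieAlgebraSet_of_real (hG : IsAlgebraicOver K G) {X : Matrix (Fin n) (Fin n) ℂ}
    (h : ∀ t : ℝ, expGL ((t : ℂ) • X) ∈ G) : X ∈ lieAlgebraSet G := by
  obtain ⟨S, hS⟩ := hG
  intro z
  rw [hS]
  intro p hp
  have ha := (differentiable_aeval_exp p X).differentiableOn.analyticOnNhd (s := Set.univ) isOpen_univ
  refine congrFun (ha.eq_of_frequently_eq (z₀ := 0) analyticOnNhd_const (g := fun _ => 0) ?_) z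
  have hs : Filter.Tendsto (fun n : ℕ => ((((n : ℝ) + 1)⁻¹ : ℝ) : ℂ)) Filter.atTop (nhdsWithin 0 {0}ᶜ) := by
    rw [tendsto_nhdsWithin_iff]
    refine ⟨?_, Filter.Eventually.of_forall fun n => ?_⟩
    · have := tendsto_one_div_add_atTop_nhds_zero_nat (𝕜 := ℂ)
      simpa using this
    · have : ((n : ℝ) + 1)⁻¹ ≠ 0 := by positivity
      exact Complex.ofReal_ne_zero.2 this
  exact hs.frequently (Filter.Frequently.of_forall fun n => (hS _).1 (h _) p hp)

theorem mem_of_tendsto_of_isAlgebraicOver (hG : IsAlgebraicOver K G) {u : ℕ → GL (Fin n) ℂ}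
    {g : GL (Fin n) ℂ} (hu : ∀ k, u k ∈ G)
    (h : Filter.Tendsto (fun k => (u k : Matrix (Fin n) (Fin n) ℂ)) Filter.atTop (nhds g)) :
    g ∈ G := by
  obtain ⟨S, hS⟩ := hG
  rw [hS]
  intro p hp
  have hc : Continuous fun M : Matrix (Fin n) (Fin n) ℂ =>
      MvPolynomial.aeval (fun ij : Fin n × Fin n => M ij.1 ij.2) p := by
    have := (MvPolynomial.continuous_eval (MvPolynomial.map (algebraMap K ℂ) p)).comp
      (f := fun (M : Matrix (Fin n) (Fin n) ℂ) (ij : Fin n × Fin n) => M ij.1 ij.2)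
      (continuous_pi fun ij => continuous_id.matrix_elem ij.1 ij.2)
    refine this.congr fun M => ?_
    simp [MvPolynomial.eval_map, MvPolynomial.aeval_def]
  refine tendsto_nhds_unique ((hc.tendsto _).comp h) ?_
  refine tendsto_const_nhds.congr fun k => ?_
  exact ((hS _).1 (hu k) p hp).symm

/-- The complex Lie algebra of a linear algebraic group, as a vector space. -/
def lieSubmodule (hG : IsAlgebraicOver K G) : Submodule ℂ (Matrix (Fin n) (Fin n) ℂ) where
  carrier := lieAlgebraSet G
  zero_mem' z := by rw [smul_zero, expGL_zero]; exact G.one_mem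
  smul_mem' c X hX z := by rw [smul_smul]; exact hX _
  add_mem' {X Y} hX hY z := by
    -- Matrices of size `0` are separated because there `‖1‖ = 1` fails, which the Lie product
    -- formula needs.
    rcases n with _ | n
    · rw [Subsingleton.elim (expGL _) 1]; exact G.one_mem
    · have := tendsto_exp_mul_exp_pow (z • X) (z • Y)
      rw [← smul_add] at this
      refine mem_of_tendsto_of_isAlgebraicOver hG (u := fun k => (expGL (((k + 1 : ℂ)⁻¹) • z • X) *
        expGL (((k + 1 : ℂ)⁻¹) • z • Y)) ^ (k + 1)) (fun k => ?_) this
      refine G.pow_mem (G.mul_mem ?_ ?_) _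
      · rw [smul_smul]; exact hX _
      · rw [smul_smul]; exact hY _

theorem mem_lieSubmodule {hG : IsAlgebraicOver K G} {X : Matrix (Fin n) (Fin n) ℂ} :
    X ∈ lieSubmodule hG ↔ ∀ z : ℂ, expGL (z • X) ∈ G := Iff.rfl

theorem conj_mem_lieSubmodule (hG : IsAlgebraicOver K G) {g : GL (Fin n) ℂ} (hg : g ∈ G)
    {X : Matrix (Fin n) (Fin n) ℂ} (hX : X ∈ lieSubmodule hG) :
    (g : Matrix (Fin n) (Fin n) ℂ) * X * ((g⁻¹ : GL (Fin n) ℂ) : Matrix (Fin n) (Fin n) ℂ) ∈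
      lieSubmodule hG := fun z => by
  rw [← Matrix.smul_mul, ← Matrix.mul_smul, expGL_units_conj]
  exact G.mul_mem (G.mul_mem hg (hX z)) (G.inv_mem hg)

/-- The bracket is the derivative at `0` of `exp (z X) * Y * exp (-z X)`. This curve stays in the
Lie algebra, a closed subspace, which therefore contains the limit of its difference quotients. -/
theorem bracket_mem_lieSubmodule (hG : IsAlgebraicOver K G) {X Y : Matrix (Fin n) (Fin n) ℂ}
    (hX : X ∈ lieSubmodule hG) (hY : Y ∈ lieSubmodule hG) : X * Y - Y * X ∈ lieSubmodule hG := by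
  have hcl : IsClosed (lieSubmodule hG : Set (Matrix (Fin n) (Fin n) ℂ)) :=
    Submodule.closed_of_finiteDimensional _
  have h1 := hasDerivAt_exp_smul_const (𝕂 := ℂ) X 0
  have h2 := hasDerivAt_exp_smul_const (𝕂 := ℂ) (-X) 0
  have h3 := (h1.mul_const Y).mul h2
  have h4 := hasDerivAt_iff_tendsto_slope_zero.1 h3
  have e : X * Y - Y * X = NormedSpace.exp ((0 : ℂ) • X) * X * Y * NormedSpace.exp ((0 : ℂ) • -X) +
      NormedSpace.exp ((0 : ℂ) • X) * Y * (NormedSpace.exp ((0 : ℂ) • -X) * -X) := by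
    simp [sub_eq_add_neg]
  rw [e]
  refine hcl.mem_of_tendsto h4 (Filter.Eventually.of_forall fun t => ?_)
  refine Submodule.smul_mem _ _ (Submodule.sub_mem _ ?_ ?_)
  · have := conj_mem_lieSubmodule hG (hX (0 + t)) hY
    rw [coe_expGL_inv, ← smul_neg] at this
    exact this
  · simpa using hY

theorem aeval_rat_map_conj (p : MvPolynomial (Fin n × Fin n) ℚ) (f : Fin n × Fin n → ℂ) :
    MvPolynomial.aeval (fun ij => starRingEnd ℂ (f ij)) p =
      starRingEnd ℂ (MvPolynomial.aeval f p) := by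
  induction p using MvPolynomial.induction_on with
  | C a => simp
  | add p q hp hq => simp [hp, hq]
  | mul_X p i hp => simp [hp]

/-- Rational coefficients are fixed by complex conjugation, so zeros are carried to zeros. -/
theorem conjGL_mem (hG : IsAlgebraicOver ℚ G) {g : GL (Fin n) ℂ} (hg : g ∈ G) : conjGL g ∈ G := by
  obtain ⟨S, hS⟩ := hG
  rw [hS] at hg ⊢
  intro p hp
  have := aeval_rat_map_conj p fun ij => (g : Matrix (Fin n) (Fin n) ℂ) ij.1 ij.2
  rw [hg p hp, map_zero] at this
  exact this

theorem map_conj_mem_lieSubmodule (hG : IsAlgebraicOver ℚ G) {X : Matrix (Fin n) (Fin n) ℂ}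
    (hX : X ∈ lieSubmodule hG) : X.map (starRingEnd ℂ) ∈ lieSubmodule hG := fun z => by
  have := conjGL_mem hG (hX (starRingEnd ℂ z))
  rw [conjGL_expGL] at this
  convert this using 2
  ext i j; simp

/-- Reduces the real Lie algebra to the complex one. That `X` is real follows by differentiating
`exp (t X) = exp (t X̄)` at `0`. -/
theorem mem_lieAlgebraReal_iff (hG : IsAlgebraicOver K G) {X : Matrix (Fin n) (Fin n) ℂ} :
    X ∈ lieAlgebraReal G ↔ X ∈ lieSubmodule hG ∧ X.map (starRingEnd ℂ) = X := by
  have hc : ∀ (t : ℝ), (t • X) = (t : ℂ) • X := fun t => by ext i j; simp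
  constructor
  · intro h
    have h' : ∀ t : ℝ, expGL ((t : ℂ) • X) ∈ realPoints G := fun t => by
      obtain ⟨g, hg, e⟩ := h t
      rw [hc] at e
      rwa [← show g = expGL ((t : ℂ) • X) from Units.ext e]
    refine ⟨mem_lieAlgebraSet_of_real hG fun t => (h' t).1, ?_⟩
    have h1 : HasDerivAt (fun t : ℝ => NormedSpace.exp (t • X)) _ 0 :=
      hasDerivAt_exp_smul_const (𝕂 := ℝ) X 0
    have h2 := (hasDerivAt_exp_smul_const (𝕂 := ℝ) (X.map (starRingEnd ℂ)) 0)
    have e : (fun t : ℝ => NormedSpace.exp (t • X)) =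
        fun t : ℝ => NormedSpace.exp (t • X.map (starRingEnd ℂ)) := by
      funext t
      have := (h' t).2
      rw [conjGL_expGL] at this
      have h3 := congrArg Units.val this
      rw [coe_expGL, coe_expGL, ← hc] at h3
      rw [← h3]
      congr 1
      ext i j; simp
    rw [e] at h1
    simpa using h2.unique h1
  · rintro ⟨h, hr⟩ t
    refine ⟨expGL ((t : ℂ) • X), ⟨h t, ?_⟩, by rw [coe_expGL, hc]⟩
    rw [conjGL_expGL]
    congr 1
    ext i j
    have := congrFun (congrFun hr i) j
    simp only [Matrix.map_apply] at this
    simp [this]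

end OneParameter

/-! ### One-parameter groups and commuting conjugates in `PGL 2` -/

section ProjectiveLinear

theorem mul_inv_apply_of_mk_eq {a b : GL (Fin 2) ℂ}
    (h : Matrix.ProjGenLinGroup.mk a = Matrix.ProjGenLinGroup.mk b) (i k l j : Fin 2) :
    a.val i k * (a⁻¹).val l j = b.val i k * (b⁻¹).val l j := by
  obtain ⟨u, rfl⟩ := Matrix.ProjGenLinGroup.mk_eq_mk_iff.1 h
  have e1 : (a * Matrix.GeneralLinearGroup.scalar (Fin 2) u).val = (u : ℂ) • a.val := by
    ext i j; simp [mul_comm]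
  have e2 : ((a * Matrix.GeneralLinearGroup.scalar (Fin 2) u)⁻¹).val = (u : ℂ)⁻¹ • (a⁻¹).val := by
    rw [_root_.mul_inv_rev, ← map_inv, Units.val_mul,
      show (Matrix.GeneralLinearGroup.scalar (Fin 2) u⁻¹).val =
        Matrix.diagonal fun _ => ((u⁻¹ : ℂˣ) : ℂ) from rfl]
    ext i j
    rw [Matrix.diagonal_mul]
    simp
  rw [e1, e2, Matrix.smul_apply, Matrix.smul_apply, smul_eq_mul, smul_eq_mul]
  field_simp

theorem sum_inv_mul_apply (a : GL (Fin 2) ℂ) (l m : Fin 2) :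
    ∑ j, (a⁻¹).val l j * a.val j m = if l = m then 1 else 0 := by
  rw [← Matrix.mul_apply, ← Units.val_mul, inv_mul_cancel, Units.val_one, Matrix.one_apply]

/-- The products `a i k * a⁻¹ l j` are the matrix entries of conjugation by `a` on the matrix units.
If conjugation is the identity, `a` is scalar, as contraction with `a` shows. -/
theorem mk_eq_one_of_mul_inv_apply {a : GL (Fin 2) ℂ}
    (h : ∀ i k l j, a.val i k * (a⁻¹).val l j = if i = k ∧ l = j then 1 else 0) :
    Matrix.ProjGenLinGroup.mk a = 1 := by
  rw [Matrix.ProjGenLinGroup.mk_eq_one,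
    Matrix.GeneralLinearGroup.mem_center_iff_val_mem_range_scalar]
  refine ⟨a.val 0 0, ?_⟩
  have key : ∀ i k l, a.val i k = if i = k then a.val l l else 0 := by
    intro i k l
    have h1 : a.val i k = ∑ j, (a.val i k * (a⁻¹).val l j) * a.val j l := by
      simp_rw [mul_assoc]
      rw [← Finset.mul_sum, sum_inv_mul_apply]; simp
    rw [h1]
    simp_rw [h]
    by_cases hik : i = k <;> simp [hik]
  ext i k
  rw [key i k 0]
  simp [Matrix.diagonal_apply]

/-- A one-parameter group in `PGL 2` whose derivative at `0` vanishes is trivial. -/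
theorem mk_eq_one_of_hasDerivAt {a : ℂ → GL (Fin 2) ℂ}
    (ha : ∀ z s, Matrix.ProjGenLinGroup.mk (a (z + s)) =
      Matrix.ProjGenLinGroup.mk (a z * a s))
    {d : Fin 2 → Fin 2 → Fin 2 → Fin 2 → ℂ}
    (hd : ∀ i k l j, HasDerivAt (fun z => (a z).val i k * ((a z)⁻¹).val l j) (d i k l j) 0)
    (h0 : ∀ r s, (r ≠ 0 ∨ s ≠ 0) → d r s 0 0 = 0) (z : ℂ) :
    Matrix.ProjGenLinGroup.mk (a z) = 1 := by
  have a0 : Matrix.ProjGenLinGroup.mk (a 0) = Matrix.ProjGenLinGroup.mk 1 := by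
    have := ha 0 0
    rw [zero_add, map_mul] at this
    simpa using this
  have c0 : ∀ i k l j, (a 0).val i k * ((a 0)⁻¹).val l j = if i = k ∧ l = j then 1 else 0 := by
    intro i k l j
    rw [mul_inv_apply_of_mk_eq a0]
    rw [inv_one, Units.val_one, Matrix.one_apply, Matrix.one_apply, ite_and]
    split_ifs <;> simp
  -- Conjugation by `a z` is multiplicative on matrix units. Differentiating at `0` makes `d` a
  -- derivation of the matrix algebra; such a derivation is determined by the entries `d r s 0 0`.
  have rel : ∀ i k l m n p, d i k l m * (if n = p then 1 else 0) +
      (if i = k then 1 else 0) * d l m n p = (if l = m then 1 else 0) * d i k n p := by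
    intro i k l m n p
    have h1 := HasDerivAt.fun_sum (u := Finset.univ) fun j _ => (hd i k l j).mul (hd j m n p)
    have h2 := (hd i k n p).const_mul (if l = m then (1 : ℂ) else 0)
    have e : (fun z => (if l = m then (1 : ℂ) else 0) * ((a z).val i k * ((a z)⁻¹).val n p)) =
        fun z => ∑ j, (a z).val i k * ((a z)⁻¹).val l j * ((a z).val j m * ((a z)⁻¹).val n p) := by
      funext z
      rw [← sum_inv_mul_apply (a z) l m, Finset.sum_mul]
      exact Finset.sum_congr rfl fun j _ => by ring
    rw [e] at h2
    have h3 := h2.unique h1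
    rw [h3]
    simp only [c0]
    rw [Finset.sum_add_distrib, Finset.sum_eq_single m, Finset.sum_eq_single l]
    · simp
    · intro j _ hj; simp [hj.symm]
    · simp
    · intro j _ hj; simp [hj]
    · simp
  have d0 : ∀ r s, d r s 0 0 = 0 := by
    intro r s
    by_cases h : r ≠ 0 ∨ s ≠ 0
    · exact h0 r s h
    · push Not at h
      obtain ⟨rfl, rfl⟩ := h
      simpa using rel 0 0 0 0 0 0
  have dall : ∀ i k l j, d i k l j = 0 := by
    intro i k l j
    simpa [d0] using rel i k l j 0 0
  -- The group law moves the vanishing of the derivative from `0` to every `z`.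
  have hz : ∀ i k l j z, HasDerivAt (fun z => (a z).val i k * ((a z)⁻¹).val l j) 0 z := by
    intro i k l j z
    have h1 : HasDerivAt (fun s => ∑ p, ∑ q, ((a z).val i p * ((a z)⁻¹).val q j) *
        ((a s).val p k * ((a s)⁻¹).val l q)) 0 0 := by
      have := HasDerivAt.fun_sum (u := Finset.univ) fun p _ =>
        HasDerivAt.fun_sum (u := Finset.univ) fun q _ =>
          (hd p k l q).const_mul ((a z).val i p * ((a z)⁻¹).val q j)
      simpa [dall] using this
    have e : (fun s => ∑ p, ∑ q, ((a z).val i p * ((a z)⁻¹).val q j) *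
        ((a s).val p k * ((a s)⁻¹).val l q)) =
        fun s => (a (z + s)).val i k * ((a (z + s))⁻¹).val l j := by
      funext s
      rw [mul_inv_apply_of_mk_eq (ha z s), _root_.mul_inv_rev, Units.val_mul, Units.val_mul,
        Matrix.mul_apply, Matrix.mul_apply, Finset.sum_mul_sum]
      exact Finset.sum_congr rfl fun p _ => Finset.sum_congr rfl fun q _ => by ring
    rw [e] at h1
    rw [← sub_self z] at h1
    have := h1.comp_sub_const z z
    simpa using this
  apply mk_eq_one_of_mul_inv_apply
  intro i k l j
  rw [← c0]
  exact is_const_of_deriv_eq_zero (fun z => (hz i k l j z).differentiableAt)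
    (fun z => (hz i k l j z).deriv) z 0

/-- An element of `PGL 2` that commutes with all its conjugates is trivial. -/
theorem ProjGenLinGroup.eq_one_of_commute_conj {x : PGL(2, ℂ)}
    (h : ∀ y, Commute x (y * x * y⁻¹)) : x = 1 := by
  induction x using Matrix.ProjGenLinGroup.induction_on with | mk a => ?_
  by_contra hne
  have hdet : a.val 0 0 * a.val 1 1 - a.val 0 1 * a.val 1 0 ≠ 0 := by
    have := (Matrix.isUnits_det_units a).ne_zero
    rwa [Matrix.det_fin_two] at this
  -- This is the determinant of the columns `u` and `a u`. If it vanishes for all `u`, every vector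
  -- is an eigenvector and `a` is scalar. Otherwise some `u` is cyclic, and in the basis `u, a u`
  -- the matrix `a` becomes the companion matrix `k`, with `p = -det a` and `q = tr a`.
  have key : ∀ u0 u1 : ℂ, u0 * (a.val 1 0 * u0 + a.val 1 1 * u1) -
      (a.val 0 0 * u0 + a.val 0 1 * u1) * u1 = 0 := by
    intro u0 u1
    by_contra hu
    set c : GL (Fin 2) ℂ := Matrix.GeneralLinearGroup.mkOfDetNeZero
      !![u0, a.val 0 0 * u0 + a.val 0 1 * u1; u1, a.val 1 0 * u0 + a.val 1 1 * u1]
      (by rwa [Matrix.det_fin_two_of]) with hc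
    set p := -(a.val 0 0 * a.val 1 1 - a.val 0 1 * a.val 1 0) with hp
    set q := a.val 0 0 + a.val 1 1 with hq
    have hp0 : p ≠ 0 := neg_ne_zero.2 hdet
    set k : GL (Fin 2) ℂ := Matrix.GeneralLinearGroup.mkOfDetNeZero !![0, p; 1, q]
      (by rw [Matrix.det_fin_two_of]; simpa using hp0) with hk
    -- Conjugating `k` by `e` gives `k'`. If `k k'` and `k' k` differ by a scalar `μ`, then
    -- comparing entries yields in turn `μ = 4`, `q = 0` and `p = 0`, contradicting `det a ≠ 0`.
    set e : GL (Fin 2) ℂ := Matrix.GeneralLinearGroup.mkOfDetNeZero !![2, 0; 0, 1]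
      (by rw [Matrix.det_fin_two_of]; simp) with he
    set k' : GL (Fin 2) ℂ := Matrix.GeneralLinearGroup.mkOfDetNeZero !![0, 2 * p; 1 / 2, q]
      (by rw [Matrix.det_fin_two_of]; simpa using hp0) with hk'
    have hac : a = c * k * c⁻¹ := by
      rw [eq_mul_inv_iff_mul_eq]
      apply Units.ext
      rw [Units.val_mul, Units.val_mul, hc, hk]
      ext i j
      fin_cases i <;> fin_cases j <;>
        simp [Matrix.GeneralLinearGroup.mkOfDetNeZero, Matrix.mul_apply, Fin.sum_univ_two, hp, hq] <;>
        ring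
    have hek : e * k = k' * e := by
      apply Units.ext
      rw [Units.val_mul, Units.val_mul, he, hk, hk']
      ext i j
      fin_cases i <;> fin_cases j <;>
        simp [Matrix.GeneralLinearGroup.mkOfDetNeZero, Matrix.mul_apply, Fin.sum_univ_two, mul_comm]
    have hek' : e * k * e⁻¹ = k' := by rw [hek, mul_inv_cancel_right]
    have h1 := h (Matrix.ProjGenLinGroup.mk (c * e * c⁻¹))
    rw [← map_inv, ← map_mul, ← map_mul, Commute, SemiconjBy, ← map_mul, ← map_mul] at h1
    have h2 := congrArg (fun t => (Matrix.ProjGenLinGroup.mk c)⁻¹ * t * Matrix.ProjGenLinGroup.mk c) h1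
    simp only [← map_inv, ← map_mul] at h2
    have e1 : c⁻¹ * (a * (c * e * c⁻¹ * a * (c * e * c⁻¹)⁻¹)) * c = k * k' := by
      rw [hac, ← hek']; group
    have e2 : c⁻¹ * (c * e * c⁻¹ * a * (c * e * c⁻¹)⁻¹ * a) * c = k' * k := by
      rw [hac, ← hek']; group
    rw [e1, e2] at h2
    obtain ⟨μ, hμ⟩ := Matrix.ProjGenLinGroup.mk_eq_mk_iff.1 h2
    have h3 : ∀ i j, (k * k').val i j * (μ : ℂ) = (k' * k).val i j := fun i j => by
      rw [← hμ]; simp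
    have h00 := h3 0 0
    have h10 := h3 1 0
    have h11 := h3 1 1
    simp [hk, hk', Matrix.GeneralLinearGroup.mkOfDetNeZero, Matrix.mul_apply, Fin.sum_univ_two]
      at h00 h10 h11
    have hμ4 : (μ : ℂ) = 4 := by
      apply mul_left_cancel₀ hp0
      linear_combination 2 * h00
    rw [hμ4] at h10 h11
    have hq0 : q = 0 := by linear_combination h10
    rw [hq0] at h11
    apply hp0
    linear_combination (2 / 15) * h11
  apply hne
  rw [Matrix.ProjGenLinGroup.mk_eq_one,
    Matrix.GeneralLinearGroup.mem_center_iff_val_mem_range_scalar]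
  have k1 := key 1 0
  have k2 := key 0 1
  have k3 := key 1 1
  have h10 : a.val 1 0 = 0 := by simpa using k1
  have h01 : a.val 0 1 = 0 := by simpa using k2
  have h11 : a.val 1 1 = a.val 0 0 := by
    rw [h10, h01] at k3
    linear_combination k3
  refine ⟨a.val 0 0, ?_⟩
  ext i j
  fin_cases i <;> fin_cases j <;> simp [h10, h01, h11]

end ProjectiveLinear

/-! ### Consequences of a discrete center and an adjoint group `PGL 2` -/

section AdjointGroup

variable {n : ℕ} {K : Type} [Field K] [Algebra K ℂ] {G : Subgroup (GL (Fin n) ℂ)}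

/-- Polynomials in the entries of `g` and of `g⁻¹` have a derivative along one-parameter groups
that is linear in the direction. -/
theorem exists_linearMap_hasDerivAt_eval_exp
    (p : MvPolynomial ((Fin n × Fin n) ⊕ (Fin n × Fin n)) ℂ) :
    ∃ Λ : Matrix (Fin n) (Fin n) ℂ →ₗ[ℂ] ℂ, ∀ X, HasDerivAt (fun z : ℂ =>
      MvPolynomial.eval (Sum.elim (fun r => (expGL (z • X)).val r.1 r.2)
        (fun r => ((expGL (z • X))⁻¹).val r.1 r.2)) p) (Λ X) 0 := by
  have hij : ∀ (X : Matrix (Fin n) (Fin n) ℂ) i j,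
      HasDerivAt (fun z : ℂ => NormedSpace.exp (z • X) i j) (X i j) 0 := fun X i j => by
    have h1 : HasDerivAt (fun z : ℂ => NormedSpace.exp (z • X)) _ 0 :=
      hasDerivAt_exp_smul_const (𝕂 := ℂ) X 0
    have h2 := ((Matrix.entryLinearMap ℂ ℂ i j).toContinuousLinearMap.hasFDerivAt).comp_hasDerivAt 0 h1
    simpa [Function.comp_def] using! h2
  induction p using MvPolynomial.induction_on with
  | C a => exact ⟨0, fun X => by simpa using hasDerivAt_const (0 : ℂ) a⟩
  | add p q hp hq =>
    obtain ⟨Λ, hΛ⟩ := hp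
    obtain ⟨M, hM⟩ := hq
    exact ⟨Λ + M, fun X => by simpa using! (hΛ X).add (hM X)⟩
  | mul_X p i hp =>
    obtain ⟨Λ, hΛ⟩ := hp
    set c := MvPolynomial.eval (Sum.elim (fun r => (1 : Matrix (Fin n) (Fin n) ℂ) r.1 r.2)
        (fun r => (1 : Matrix (Fin n) (Fin n) ℂ) r.1 r.2)) p with hc
    have c0 : ∀ X : Matrix (Fin n) (Fin n) ℂ, MvPolynomial.eval (Sum.elim
        (fun r => (expGL ((0 : ℂ) • X)).val r.1 r.2)
        (fun r => ((expGL ((0 : ℂ) • X))⁻¹).val r.1 r.2)) p = c := fun X => by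
      rw [zero_smul, expGL_zero, inv_one]; rfl
    rcases i with ⟨i, j⟩ | ⟨i, j⟩
    · refine ⟨((1 : Matrix (Fin n) (Fin n) ℂ) i j) • Λ + c • Matrix.entryLinearMap ℂ ℂ i j, fun X => ?_⟩
      have := (hΛ X).mul (hij X i j)
      rw [c0] at this
      simp only [map_mul, MvPolynomial.eval_X, Sum.elim_inl]
      refine this.congr_deriv ?_
      simp [mul_comm]
    · refine ⟨((1 : Matrix (Fin n) (Fin n) ℂ) i j) • Λ + c • -Matrix.entryLinearMap ℂ ℂ i j, fun X => ?_⟩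
      have h2 : HasDerivAt (fun z : ℂ => ((expGL (z • X))⁻¹).val i j) (-X i j) 0 := by
        have := hij (-X) i j
        simp_rw [smul_neg] at this
        exact this
      have := (hΛ X).mul h2
      rw [c0] at this
      simp only [map_mul, MvPolynomial.eval_X, Sum.elim_inr]
      refine this.congr_deriv ?_
      simp [expGL_zero, mul_comm]

theorem expGL_add_smul (X : Matrix (Fin n) (Fin n) ℂ) (z s : ℂ) :
    expGL ((z + s) • X) = expGL (z • X) * expGL (s • X) := by
  rw [add_smul]
  exact expGL_add (((Commute.refl X).smul_left z).smul_right s)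

/-- The Lie algebra contains no non-zero element whose one-parameter group is contained in a
discrete center. -/
theorem eq_zero_of_expGL_mem_center (hc : DiscreteTopology (Subgroup.center G))
    {X : Matrix (Fin n) (Fin n) ℂ} (hX : ∀ z : ℂ, expGL (z • X) ∈ G)
    (h : ∀ z : ℂ, (⟨expGL (z • X), hX z⟩ : G) ∈ Subgroup.center G) : X = 0 := by
  have hcont : Continuous fun z : ℂ =>
      (⟨⟨expGL (z • X), hX z⟩, h z⟩ : Subgroup.center G) :=
    ((continuous_expGL_smul X).subtype_mk _).subtype_mk _
  apply eq_zero_of_expGL_smul_eq_one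
  intro z
  -- A continuous map from the connected space `ℂ` to a discrete space is constant.
  have h1 := PreconnectedSpace.constant (inferInstance : PreconnectedSpace ℂ) hcont (x := z) (y := 0)
  have h2 := congrArg (fun g : Subgroup.center G => ((g : G) : GL (Fin n) ℂ)) h1
  simpa [expGL_zero] using h2

/-- The differential of `φ` is injective: if it kills `X`, then `φ` is trivial on the one-parameter
group of `X`, which lies in the discrete center, so `X = 0`. -/
theorem finrank_lieSubmodule_le (hG : IsAlgebraicOver K G)
    (hc : DiscreteTopology (Subgroup.center G)) {φ : G →* PGL(2, ℂ)}
    (hker : φ.ker = Subgroup.center G) (hφ : IsRegularToPGL φ) :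
    Module.finrank ℂ (lieSubmodule hG) ≤ 3 := by
  choose p hp using hφ
  choose Λ hΛ using fun i j k l => exists_linearMap_hasDerivAt_eval_exp (p i j k l)
  -- These are the three derivatives `d r s 0 0` with `(r, s) ≠ (0, 0)` required by
  -- `mk_eq_one_of_hasDerivAt`.
  set L : Matrix (Fin n) (Fin n) ℂ →ₗ[ℂ] (Fin 3 → ℂ) :=
    LinearMap.pi ![Λ 0 0 1 0, Λ 1 0 0 0, Λ 1 0 1 0] with hL
  have inj : Function.Injective (L.domRestrict (lieSubmodule hG)) := by
    rw [← LinearMap.ker_eq_bot, LinearMap.ker_eq_bot']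
    rintro ⟨X, hX⟩ h
    have hX' : ∀ z : ℂ, expGL (z • X) ∈ G := hX
    have hl : ∀ i, L X i = 0 := fun i => congrFun h i
    choose a ha using fun z => Matrix.ProjGenLinGroup.mk_surjective (φ ⟨_, hX' z⟩)
    have hone := mk_eq_one_of_hasDerivAt (a := a) (d := fun i k l j => Λ i j k l X) (fun z s => by
        rw [map_mul, ha, ha, ha, ← map_mul]
        congr 1
        exact Subtype.ext (expGL_add_smul X z s))
      (fun i k l j => by
        refine (hΛ i j k l X).congr_of_eventuallyEq (Filter.Eventually.of_forall fun z => ?_)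
        exact hp i j k l ⟨_, hX' z⟩ (a z) (ha z))
      (fun r s hrs => by
        have h0 := hl 0
        have h1 := hl 1
        have h2 := hl 2
        simp [hL] at h0 h1 h2
        fin_cases r <;> fin_cases s <;> simp_all)
    refine Subtype.ext (eq_zero_of_expGL_mem_center hc hX' fun z => ?_)
    rw [← hker, MonoidHom.mem_ker, ← ha, hone]
  have := LinearMap.finrank_le_finrank_of_injective inj
  simpa using this

/-- A Lie algebra element commuting with all its conjugates under the group is zero. -/
theorem eq_zero_of_commute_conj (hG : IsAlgebraicOver K G)
    (hc : DiscreteTopology (Subgroup.center G)) {φ : G →* PGL(2, ℂ)}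
    (hker : φ.ker = Subgroup.center G) (hsurj : Function.Surjective φ)
    {X : Matrix (Fin n) (Fin n) ℂ} (hX : X ∈ lieSubmodule hG)
    (h : ∀ g ∈ G, Commute X (g.val * X * (g⁻¹).val)) : X = 0 := by
  have hX' : ∀ z : ℂ, expGL (z • X) ∈ G := hX
  refine eq_zero_of_expGL_mem_center hc hX' fun z => ?_
  rw [← hker, MonoidHom.mem_ker]
  refine ProjGenLinGroup.eq_one_of_commute_conj fun y => ?_
  -- By surjectivity every conjugate in `PGL 2` comes from a conjugate under `G`, where commuting
  -- matrices have commuting exponentials.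
  obtain ⟨g, rfl⟩ := hsurj y
  rw [← map_inv, ← map_mul, ← map_mul]
  refine Commute.map ?_ φ
  refine Subtype.ext ?_
  change expGL (z • X) * (g.1 * expGL (z • X) * g.1⁻¹) = (g.1 * expGL (z • X) * g.1⁻¹) * expGL (z • X)
  rw [← expGL_units_conj]
  have hcm : Commute (z • X) (g.1.val * (z • X) * (g.1⁻¹).val) := by
    rw [Matrix.mul_smul, Matrix.smul_mul]
    exact ((h g.1 g.2).smul_left z).smul_right z
  rw [← expGL_add hcm, ← expGL_add hcm.symm, add_comm]

end AdjointGroup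

/-! ### Weights and the real form, in an adapted basis -/

section RealForm

/-- The matrix `diag(3, 1, -1, -3)`. -/
def weightMatrix : Matrix (Fin 4) (Fin 4) ℂ := Matrix.diagonal ![3, 1, -1, -3]

/-- The Gram matrix of the polarization in an adapted basis. -/
def hodgeGram : Matrix (Fin 4) (Fin 4) ℂ := !![0, 0, 0, -I; 0, 0, I, 0; 0, -I, 0, 0; I, 0, 0, 0]

/-- Complex conjugation of matrices in a basis with `conj v_i = v_{3-i}`. -/
def conjRev (X : Matrix (Fin 4) (Fin 4) ℂ) : Matrix (Fin 4) (Fin 4) ℂ :=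
  Matrix.of fun i j => starRingEnd ℂ (X i.rev j.rev)

theorem conjRev_apply (X : Matrix (Fin 4) (Fin 4) ℂ) (i j : Fin 4) :
    conjRev X i j = starRingEnd ℂ (X i.rev j.rev) := rfl

theorem weightMatrix_bracket_apply (X : Matrix (Fin 4) (Fin 4) ℂ) (i j : Fin 4) :
    (weightMatrix * X - X * weightMatrix) i j = 2 * (((j : ℤ) - (i : ℤ) : ℤ) : ℂ) * X i j := by
  rw [weightMatrix, Matrix.sub_apply, Matrix.diagonal_mul, Matrix.mul_diagonal]
  fin_cases i <;> fin_cases j <;> simp <;> ring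

variable {W : Submodule ℂ (Matrix (Fin 4) (Fin 4) ℂ)}

/-- Half the bracket with `weightMatrix` multiplies the entry `(i, j)` by its weight `j - i`.
Polynomials in this operator preserve `W` and serve to cut out a single weight. -/
theorem prod_weight_mem (hH : weightMatrix ∈ W)
    (hbr : ∀ X ∈ W, ∀ Y ∈ W, X * Y - Y * X ∈ W) {X : Matrix (Fin 4) (Fin 4) ℂ} (hX : X ∈ W)
    (s : Finset ℤ) : (Matrix.of fun i j : Fin 4 =>
      (∏ n ∈ s, ((((j : ℤ) - (i : ℤ) - n : ℤ)) : ℂ)) * X i j) ∈ W := by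
  induction s using Finset.induction_on with
  | empty => simpa using! hX
  | insert n s hn ih =>
    set Y : Matrix (Fin 4) (Fin 4) ℂ := Matrix.of fun i j : Fin 4 =>
      (∏ n ∈ s, ((((j : ℤ) - (i : ℤ) - n : ℤ)) : ℂ)) * X i j with hY
    have h1 := W.sub_mem (W.smul_mem (1 / 2 : ℂ) (hbr _ hH _ ih)) (W.smul_mem (n : ℂ) ih)
    convert h1 using 1
    ext i j
    rw [Matrix.sub_apply, Matrix.smul_apply, weightMatrix_bracket_apply, Matrix.smul_apply]
    simp only [hY, Matrix.of_apply, Finset.prod_insert hn, smul_eq_mul]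
    push_cast
    ring

theorem exists_positive_weight (hH : weightMatrix ∈ W)
    (hbr : ∀ X ∈ W, ∀ Y ∈ W, X * Y - Y * X ∈ W) (hconj : ∀ X ∈ W, conjRev X ∈ W)
    {X : Matrix (Fin 4) (Fin 4) ℂ} (hX : X ∈ W) {i₀ j₀ : Fin 4} (hij : i₀ ≠ j₀)
    (hne : X i₀ j₀ ≠ 0) :
    ∃ E ∈ W, E ≠ 0 ∧ ∃ m : ℤ, 0 < m ∧ ∀ i j : Fin 4, (j : ℤ) - (i : ℤ) ≠ m → E i j = 0 := by
  have hb : ∀ i : Fin 4, 0 ≤ (i : ℤ) ∧ (i : ℤ) ≤ 3 := fun i => by omega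
  obtain ⟨E, hE, hE0, m, hm, hEm⟩ : ∃ E ∈ W, E ≠ 0 ∧ ∃ m : ℤ, m ≠ 0 ∧
      ∀ i j : Fin 4, (j : ℤ) - (i : ℤ) ≠ m → E i j = 0 := by
    -- All weights of a 4 by 4 matrix lie between `-3` and `3`; the product kills all of them except
    -- that of the chosen entry.
    refine ⟨_, prod_weight_mem hH hbr hX ((Finset.Icc (-3) 3).erase ((j₀ : ℤ) - (i₀ : ℤ))), ?_,
      (j₀ : ℤ) - (i₀ : ℤ), ?_, ?_⟩
    · intro h0
      have h1 := congrFun (congrFun h0 i₀) j₀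
      simp only [Matrix.of_apply, Matrix.zero_apply, mul_eq_zero, hne, or_false,
        Finset.prod_eq_zero_iff] at h1
      obtain ⟨n, hn, h2⟩ := h1
      have h3 : (j₀ : ℤ) - (i₀ : ℤ) - n = 0 := by exact_mod_cast h2
      exact (Finset.mem_erase.1 hn).1 (by omega)
    · intro h
      exact hij (Fin.ext (by omega))
    · intro i j h
      rw [Matrix.of_apply, Finset.prod_eq_zero (i := (j : ℤ) - (i : ℤ)), zero_mul]
      · rw [Finset.mem_erase, Finset.mem_Icc]
        have := hb i
        have := hb j
        exact ⟨h, by omega, by omega⟩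
      · simp
  rcases hm.lt_or_gt with h | h
  -- Reversing both indices negates the weight.
  · refine ⟨conjRev E, hconj E hE, ?_, -m, by omega, fun i j hn => ?_⟩
    · intro h0
      apply hE0
      ext i j
      have := congrFun (congrFun h0 i.rev) j.rev
      rw [conjRev_apply, Fin.rev_rev, Fin.rev_rev] at this
      simpa using this
    · rw [conjRev_apply, hEm, map_zero]
      rw [Fin.val_rev, Fin.val_rev]
      omega
  · exact ⟨E, hE, hE0, m, h, hEm⟩

/-- The three matrices are non-zero of the distinct weights `0`, `m` and `-m`, hence independent,
and `W` has dimension at most `3`. -/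
theorem exists_eq_combination (hdim : Module.finrank ℂ W ≤ 3) (hH : weightMatrix ∈ W)
    (hconj : ∀ X ∈ W, conjRev X ∈ W) {E : Matrix (Fin 4) (Fin 4) ℂ} (hE : E ∈ W) (hE0 : E ≠ 0)
    {m : ℤ} (hm : 0 < m) (hEm : ∀ i j : Fin 4, (j : ℤ) - (i : ℤ) ≠ m → E i j = 0)
    {M : Matrix (Fin 4) (Fin 4) ℂ} (hM : M ∈ W) :
    ∃ α β γ : ℂ, α • weightMatrix + β • E + γ • conjRev E = M := by
  have hF : ∀ i j : Fin 4, (j : ℤ) - (i : ℤ) ≠ -m → conjRev E i j = 0 := fun i j h => by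
    rw [conjRev_apply, hEm, map_zero]
    rw [Fin.val_rev, Fin.val_rev]
    omega
  obtain ⟨i, j, hij⟩ : ∃ i j, E i j ≠ 0 := by
    by_contra! h
    exact hE0 (Matrix.ext h)
  have hijm : (j : ℤ) - (i : ℤ) = m := by
    by_contra h
    exact hij (hEm i j h)
  have hne : i ≠ j := by rintro rfl; omega
  have hne' : i.rev ≠ j.rev := fun h => hne (Fin.rev_injective h)
  have li : LinearIndependent ℂ ![weightMatrix, E, conjRev E] := by
    rw [Fintype.linearIndependent_iff]
    intro g hg
    simp only [Fin.sum_univ_three] at hg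
    have hg' : ∀ k l, g 0 * weightMatrix k l + g 1 * E k l + g 2 * conjRev E k l = 0 := fun k l => by
      simpa using congrFun (congrFun hg k) l
    have h0 := hg' 0 0
    rw [hEm 0 0 (by simpa using hm.ne), hF 0 0 (by simpa using hm.ne')] at h0
    have h1 := hg' i j
    rw [hF i j (by omega), weightMatrix, Matrix.diagonal_apply_ne _ hne] at h1
    have h2 := hg' i.rev j.rev
    rw [conjRev_apply, Fin.rev_rev, Fin.rev_rev, weightMatrix, Matrix.diagonal_apply_ne _ hne',
      hEm i.rev j.rev (by rw [Fin.val_rev, Fin.val_rev]; omega)] at h2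
    intro k
    fin_cases k
    · simpa [weightMatrix] using h0
    · simpa [hij] using h1
    · simpa [hij] using h2
  have hle : Submodule.span ℂ (Set.range ![weightMatrix, E, conjRev E]) ≤ W := by
    rw [Submodule.span_le, Set.range_subset_iff]
    intro k
    fin_cases k
    · exact hH
    · exact hE
    · exact hconj E hE
  have heq := Submodule.eq_of_le_of_finrank_le hle (by
    rw [finrank_span_eq_card li]; simpa using hdim)
  rw [← heq] at hM
  have hr : Set.range ![weightMatrix, E, conjRev E] = {weightMatrix, E, conjRev E} := by
    rw [Matrix.range_cons, Matrix.range_cons, Matrix.range_cons, Matrix.range_empty,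
      Set.union_empty]
    rfl
  rw [hr] at hM
  exact Submodule.mem_span_triple.1 hM

/-- The raising operator with entries `1, x, 1`. -/
def raisingMatrix (x : ℂ) : Matrix (Fin 4) (Fin 4) ℂ :=
  !![0, 1, 0, 0; 0, 0, x, 0; 0, 0, 0, 1; 0, 0, 0, 0]

theorem conjRev_of (a₀₀ a₀₁ a₀₂ a₀₃ a₁₀ a₁₁ a₁₂ a₁₃ a₂₀ a₂₁ a₂₂ a₂₃ a₃₀ a₃₁ a₃₂ a₃₃ : ℂ) :
    conjRev !![a₀₀, a₀₁, a₀₂, a₀₃; a₁₀, a₁₁, a₁₂, a₁₃; a₂₀, a₂₁, a₂₂, a₂₃; a₃₀, a₃₁, a₃₂, a₃₃] =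
      !![star a₃₃, star a₃₂, star a₃₁, star a₃₀; star a₂₃, star a₂₂, star a₂₁, star a₂₀;
        star a₁₃, star a₁₂, star a₁₁, star a₁₀; star a₀₃, star a₀₂, star a₀₁, star a₀₀] := by
  ext i j
  fin_cases i <;> fin_cases j <;> rfl

/-- The weight of the positive root is the one of the third symmetric power. -/
theorem exists_raisingMatrix_mem (hdim : Module.finrank ℂ W ≤ 3) (hH : weightMatrix ∈ W)
    (hbr : ∀ X ∈ W, ∀ Y ∈ W, X * Y - Y * X ∈ W) (hconj : ∀ X ∈ W, conjRev X ∈ W)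
    (hsp : ∀ X ∈ W, Xᵀ * hodgeGram + hodgeGram * X = 0)
    {E : Matrix (Fin 4) (Fin 4) ℂ} (hE : E ∈ W) (hE0 : E ≠ 0)
    {m : ℤ} (hm : 0 < m) (hEm : ∀ i j : Fin 4, (j : ℤ) - (i : ℤ) ≠ m → E i j = 0) :
    ∃ x : ℂ, raisingMatrix x ∈ W ∧ ‖x‖ ^ 2 = 4 / 3 := by
  -- `E` and its conjugate have zero diagonal, so on the diagonal the bracket equals `α •
  -- weightMatrix`: its first two entries are `3 α` and `α`.
  obtain ⟨α, β, γ, hD⟩ := exists_eq_combination hdim hH hconj hE hE0 hm hEm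
    (hbr _ hE _ (hconj _ hE))
  have hsE := hsp E hE
  have hm3 : m ≤ 3 := by
    by_contra h
    apply hE0
    ext i j
    exact hEm i j (by omega)
  obtain rfl | rfl | rfl : m = 1 ∨ m = 2 ∨ m = 3 := by omega
  · obtain ⟨a, c, d, rfl⟩ : ∃ a c d : ℂ, E = !![0, a, 0, 0; 0, 0, c, 0; 0, 0, 0, d; 0, 0, 0, 0] := by
      refine ⟨E 0 1, E 1 2, E 2 3, ?_⟩
      ext i j
      fin_cases i <;> fin_cases j <;> first | rfl | exact hEm _ _ (by simp)
    have h13 := congrFun (congrFun hsE 1) 3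
    have had : d = a := by
      simp [hodgeGram, Matrix.mul_apply, Fin.sum_univ_four] at h13
      apply mul_left_cancel₀ I_ne_zero
      linear_combination h13
    subst had
    have h00 := congrFun (congrFun hD 0) 0
    have h11 := congrFun (congrFun hD 1) 1
    rw [conjRev_of] at h00 h11
    simp [weightMatrix, Complex.mul_conj', Complex.conj_mul'] at h00 h11
    have hd0 : d ≠ 0 := by
      rintro rfl
      have hα : α = 0 := by simpa using h00
      have hc : c = 0 := by
        rw [hα] at h11
        simpa using h11.symm
      apply hE0
      ext i j
      fin_cases i <;> fin_cases j <;> simp [hc]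
    refine ⟨c / d, ?_, ?_⟩
    · convert W.smul_mem d⁻¹ hE using 1
      ext i j
      fin_cases i <;> fin_cases j <;> simp [raisingMatrix, hd0, div_eq_inv_mul]
    · rw [norm_div, div_pow, div_eq_iff (by simpa using hd0)]
      -- Here `3 α = |d|²` and `α = |c|² - |d|²`.
      have : (‖c‖ : ℂ) ^ 2 = 4 / 3 * (‖d‖ : ℂ) ^ 2 := by linear_combination (1 / 3) * h00 - h11
      apply Complex.ofReal_injective
      push_cast
      exact this
  · exfalso
    obtain ⟨a, d, rfl⟩ : ∃ a d : ℂ, E = !![0, 0, a, 0; 0, 0, 0, d; 0, 0, 0, 0; 0, 0, 0, 0] := by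
      refine ⟨E 0 2, E 1 3, ?_⟩
      ext i j
      fin_cases i <;> fin_cases j <;> first | rfl | exact hEm _ _ (by simp)
    have h23 := congrFun (congrFun hsE 2) 3
    have had : d = -a := by
      simp [hodgeGram, Matrix.mul_apply, Fin.sum_univ_four] at h23
      apply mul_left_cancel₀ I_ne_zero
      linear_combination -h23
    subst had
    have h00 := congrFun (congrFun hD 0) 0
    have h11 := congrFun (congrFun hD 1) 1
    rw [conjRev_of] at h00 h11
    simp [weightMatrix, Complex.mul_conj', Complex.conj_mul'] at h00 h11
    -- Both diagonal entries of the bracket are `-|a|²`, yet they should be `3 α` and `α`.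
    have ha : (‖a‖ : ℂ) ^ 2 = 0 := by linear_combination (3 / 2) * h11 - (1 / 2) * h00
    have ha0 : a = 0 := by simpa using ha
    apply hE0
    ext i j
    fin_cases i <;> fin_cases j <;> simp [ha0]
  · exfalso
    obtain ⟨a, rfl⟩ : ∃ a : ℂ, E = !![0, 0, 0, a; 0, 0, 0, 0; 0, 0, 0, 0; 0, 0, 0, 0] := by
      refine ⟨E 0 3, ?_⟩
      ext i j
      fin_cases i <;> fin_cases j <;> first | rfl | exact hEm _ _ (by simp)
    have h00 := congrFun (congrFun hD 0) 0
    have h11 := congrFun (congrFun hD 1) 1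
    rw [conjRev_of] at h00 h11
    simp [weightMatrix, Complex.mul_conj', Complex.conj_mul'] at h00 h11
    rw [h11] at h00
    have ha0 : a = 0 := by simpa using h00.symm
    apply hE0
    ext i j
    fin_cases i <;> fin_cases j <;> simp [ha0]

theorem mem_spanXY_iff {x y : ℂ} {M : Matrix (Fin 4) (Fin 4) ℂ} : M ∈ spanXY x y ↔
    ∃ r s t : ℝ, M = !![3 * r * I, s + t * I, 0, 0;
      s - t * I, r * I, s * x + t * y, 0;
      0, s * starRingEnd ℂ x + t * starRingEnd ℂ y, -r * I, s + t * I;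
      0, 0, s - t * I, -3 * r * I] := by
  rw [spanXY, Submodule.mem_span_triple]
  refine exists_congr fun r => exists_congr fun s => exists_congr fun t => ?_
  rw [eq_comm]
  apply Eq.congr_right
  ext i j
  fin_cases i <;> fin_cases j <;> simp <;> ring

/-- `conjRev` negates `weightMatrix`, so a combination with coefficients `α, β, γ` is real exactly
when `α` is imaginary and `γ` is conjugate to `β`. Writing `β = s + t I` produces the second and
third generators, with `y = I * x`. -/
theorem real_points_eq_spanXY (hdim : Module.finrank ℂ W ≤ 3) (hH : weightMatrix ∈ W)
    (hconj : ∀ X ∈ W, conjRev X ∈ W) {x : ℂ} (hx : raisingMatrix x ∈ W)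
    {M : Matrix (Fin 4) (Fin 4) ℂ} :
    M ∈ spanXY x (I * x) ↔ M ∈ W ∧ conjRev M = M := by
  rw [mem_spanXY_iff]
  constructor
  · rintro ⟨r, s, t, rfl⟩
    constructor
    · have := W.add_mem (W.add_mem (W.smul_mem (r * I) hH) (W.smul_mem (s + t * I) hx))
        (W.smul_mem (s - t * I) (hconj _ hx))
      convert this using 1
      rw [raisingMatrix, conjRev_of]
      ext i j
      fin_cases i <;> fin_cases j <;> simp [weightMatrix] <;> ring
    · rw [conjRev_of]
      ext i j
      fin_cases i <;> fin_cases j <;> simp <;> ring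
  · rintro ⟨hM, hr⟩
    have hne : raisingMatrix x ≠ 0 := fun h => by
      simpa [raisingMatrix] using congrFun (congrFun h 0) 1
    obtain ⟨α, β, γ, h⟩ := exists_eq_combination hdim hH hconj hx hne (m := 1) one_pos
      (fun i j => by fin_cases i <;> fin_cases j <;> simp [raisingMatrix]) hM
    rw [raisingMatrix, conjRev_of] at h
    have h00 := congrFun (congrFun hr 0) 0
    have h01 := congrFun (congrFun hr 0) 1
    rw [← h, conjRev_apply] at h00 h01
    simp [weightMatrix] at h00 h01
    refine ⟨α.im, β.re, β.im, ?_⟩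
    have hα : α = α.im * I := by
      apply Complex.ext
      · have := congrArg Complex.re h00
        simp at this ⊢
        linarith
      · simp
    have hβ : (β.re : ℂ) + β.im * I = β := Complex.re_add_im β
    have hγ : (β.re : ℂ) - β.im * I = γ := by
      rw [← h01] at *
      apply Complex.ext <;> simp
    rw [hβ, hγ, ← h]
    have hβx : (β.re : ℂ) * x + β.im * (I * x) = β * x := by
      rw [← mul_assoc, ← add_mul, hβ]
    have hγx : (β.re : ℂ) * starRingEnd ℂ x + β.im * (starRingEnd ℂ (I * x)) =
        γ * starRingEnd ℂ x := by
      rw [← hγ, map_mul, conj_I]; ring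
    rw [hβx, hγx]
    ext i j
    fin_cases i <;> fin_cases j <;> simp [weightMatrix] <;>
      first
      | linear_combination 3 * hα
      | linear_combination hα

/-- The entry `(0, 1)` is `s + t I` with `s, t` real, so it determines both coefficients. The entry
`(1, 2)` then recovers `x` and `y`. -/
theorem eq_of_spanXY_eq {x x' y' : ℂ}
    (h : (spanXY x (I * x) : Set (Matrix (Fin 4) (Fin 4) ℂ)) = spanXY x' y') :
    x' = x ∧ y' = I * x := by
  have key : ∀ s t : ℝ, s * x' + t * y' = s * x + t * (I * x) := by
    intro s t
    have h1 : (_ : Matrix (Fin 4) (Fin 4) ℂ) ∈ (spanXY x' y' : Set _) :=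
      mem_spanXY_iff.2 ⟨0, s, t, rfl⟩
    rw [← h] at h1
    obtain ⟨r', s', t', e⟩ := mem_spanXY_iff.1 h1
    have e01 := congrFun (congrFun e 0) 1
    have e12 := congrFun (congrFun e 1) 2
    simp at e01 e12
    have hs : s = s' := by simpa using congrArg Complex.re e01
    have ht : t = t' := by simpa using congrArg Complex.im e01
    rw [e12, hs, ht]
  exact ⟨by simpa using key 1 0, by simpa using key 0 1⟩

end RealForm

/-! ### The isometry group of the polarization and its Lie algebra -/

section Symplectic

variable {n : ℕ}

/-- The group of complex points of the isometry group of the bilinear form with Gram matrix `Q`. -/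
def isometryGroup (Q : Matrix (Fin n) (Fin n) ℚ) : Subgroup (GL (Fin n) ℂ) where
  carrier := {g | g.valᵀ * Q.map (fun q : ℚ => (q : ℂ)) * g.val = Q.map (fun q : ℚ => (q : ℂ))}
  one_mem' := by simp
  mul_mem' {a b} ha hb := by
    simp only [Set.mem_ofPred_eq] at ha hb ⊢
    calc _ = b.valᵀ * (a.valᵀ * Q.map (fun q : ℚ => (q : ℂ)) * a.val) * b.val := by
          rw [Units.val_mul, Matrix.transpose_mul]; simp only [Matrix.mul_assoc]
      _ = _ := by rw [ha, hb]
  inv_mem' {a} ha := by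
    simp only [Set.mem_ofPred_eq] at ha ⊢
    have h1 : a.val * (a⁻¹).val = 1 := by rw [← Units.val_mul]; simp
    have h2 : (a⁻¹).valᵀ * a.valᵀ = 1 := by rw [← Matrix.transpose_mul, h1, Matrix.transpose_one]
    calc _ = ((a⁻¹).valᵀ * a.valᵀ) * Q.map (fun q : ℚ => (q : ℂ)) * (a.val * (a⁻¹).val) := by
          conv_lhs => rw [← ha]
          simp only [Matrix.mul_assoc]
      _ = _ := by rw [h1, h2]; simp

theorem mem_isometryGroup {Q : Matrix (Fin n) (Fin n) ℚ} {g : GL (Fin n) ℂ} :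
    g ∈ isometryGroup Q ↔
      g.valᵀ * Q.map (fun q : ℚ => (q : ℂ)) * g.val = Q.map (fun q : ℚ => (q : ℂ)) := Iff.rfl

theorem isAlgebraicOver_isometryGroup (Q : Matrix (Fin n) (Fin n) ℚ) :
    IsAlgebraicOver ℚ (isometryGroup Q) := by
  refine ⟨Set.range fun ij : Fin n × Fin n => ∑ l, (∑ k, MvPolynomial.X (k, ij.1) *
    MvPolynomial.C (Q k l)) * MvPolynomial.X (l, ij.2) - MvPolynomial.C (Q ij.1 ij.2), fun g => ?_⟩
  rw [mem_isometryGroup, ← Matrix.ext_iff, Set.forall_mem_range, Prod.forall]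
  refine forall_congr' fun i => forall_congr' fun j => ?_
  simp [Matrix.mul_apply, sub_eq_zero]

theorem transpose_mul_add_mul_eq_zero {Q : Matrix (Fin n) (Fin n) ℚ}
    {X : Matrix (Fin n) (Fin n) ℂ} (h : ∀ z : ℂ, expGL (z • X) ∈ isometryGroup Q) :
    Xᵀ * Q.map (fun q : ℚ => (q : ℂ)) + Q.map (fun q : ℚ => (q : ℂ)) * X = 0 := by
  have h1 : HasDerivAt (fun z : ℂ => NormedSpace.exp (z • X)) _ 0 :=
    hasDerivAt_exp_smul_const (𝕂 := ℂ) X 0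
  have h2 : HasDerivAt (fun z : ℂ => NormedSpace.exp (z • Xᵀ)) _ 0 :=
    hasDerivAt_exp_smul_const (𝕂 := ℂ) Xᵀ 0
  have h3 := (h2.mul_const (Q.map (fun q : ℚ => (q : ℂ)))).mul h1
  have h4 := h3.unique ((hasDerivAt_const (0 : ℂ)
    (Q.map (fun q : ℚ => (q : ℂ)))).congr_of_eventuallyEq (Filter.Eventually.of_forall fun z => by
      have := mem_isometryGroup.1 (h z)
      rw [coe_expGL, ← Matrix.exp_transpose, Matrix.transpose_smul] at this
      exact this))
  simpa using h4

end Symplectic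

/-! ### Passage to the matrix in a given basis -/

section BasisChange

variable (v : Module.Basis (Fin 4) ℂ (Fin 4 → ℂ))

/-- The matrix with respect to the basis `v` of the endomorphism with the given matrix in the
standard basis. -/
noncomputable def basisChange : Matrix (Fin 4) (Fin 4) ℂ ≃ₐ[ℂ] Matrix (Fin 4) (Fin 4) ℂ :=
  Matrix.toLinAlgEquiv'.trans (LinearMap.toMatrixAlgEquiv v)

theorem basisChange_apply (X : Matrix (Fin 4) (Fin 4) ℂ) :
    basisChange v X = LinearMap.toMatrix v v (Matrix.toLin' X) := rfl

/-- The matrix whose columns are the vectors of the basis `v`. -/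
noncomputable def basisMatrix : Matrix (Fin 4) (Fin 4) ℂ := Matrix.of fun i j => v j i

theorem mulVec_basis (X : Matrix (Fin 4) (Fin 4) ℂ) (j : Fin 4) :
    X *ᵥ v j = ∑ i, basisChange v X i j • v i := by
  simp_rw [basisChange_apply, LinearMap.toMatrix_apply]
  rw [v.sum_repr, Matrix.toLin'_apply]

theorem basisChange_eq_of_mulVec {X M : Matrix (Fin 4) (Fin 4) ℂ}
    (h : ∀ j, X *ᵥ v j = ∑ i, M i j • v i) : basisChange v X = M := by
  ext i j
  rw [basisChange_apply, LinearMap.toMatrix_apply, Matrix.toLin'_apply, h, v.repr_sum_self]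

theorem mul_basisMatrix (X : Matrix (Fin 4) (Fin 4) ℂ) :
    X * basisMatrix v = basisMatrix v * basisChange v X := by
  ext i j
  have := congrFun (mulVec_basis v X j) i
  simp only [Matrix.mulVec, dotProduct, Finset.sum_apply, Pi.smul_apply, smul_eq_mul] at this
  simp only [Matrix.mul_apply, basisMatrix, Matrix.of_apply]
  rw [this]
  exact Finset.sum_congr rfl fun k _ => mul_comm _ _

theorem isUnit_basisMatrix : IsUnit (basisMatrix v) := by
  rw [← Matrix.linearIndependent_cols_iff_isUnit]
  exact v.linearIndependent

theorem basisMatrix_injective {A C : Matrix (Fin 4) (Fin 4) ℂ}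
    (h : (basisMatrix v)ᵀ * A * basisMatrix v = (basisMatrix v)ᵀ * C * basisMatrix v) : A = C := by
  have hB := isUnit_basisMatrix v
  have hBt : IsUnit (basisMatrix v)ᵀ := (Matrix.isUnit_transpose _).2 hB
  exact hBt.mul_left_cancel (hB.mul_right_cancel h)

theorem exp_basisChange (X : Matrix (Fin 4) (Fin 4) ℂ) :
    basisChange v (NormedSpace.exp X) = NormedSpace.exp (basisChange v X) :=
  NormedSpace.map_exp (basisChange v)
    (LinearMap.continuous_of_finiteDimensional (basisChange v).toLinearMap) X

end BasisChange

/-! ### The Lie algebra of the generic Hodge group -/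

namespace PolarizedVHS

variable (V : PolarizedVHS)

theorem isAlgebraicOver_genericHodgeGroup : IsAlgebraicOver ℚ V.genericHodgeGroup :=
  IsAlgebraicOver.sInf fun _ hG => hG.1

theorem mem_genericHodgeGroup {b z : ℂ} (hb : b ∈ V.B) (hz : ‖z‖ = 1) {g : GL (Fin 4) ℂ}
    (hg : V.IsHodgeAction b z g) : g ∈ V.genericHodgeGroup := by
  rw [genericHodgeGroup, Subgroup.mem_sInf]
  intro G hG
  apply hG.2 b hb
  rw [hodgeGroup, Subgroup.mem_sInf]
  exact fun G' hG' => hG'.2 z hz g hg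

variable {V} {b : ℂ} {v : Module.Basis (Fin 4) ℂ (Fin 4 → ℂ)}

theorem IsHodgeBasis.star_apply (hv : V.IsHodgeBasis b v) (i : Fin 4) : star (v i) = v i.rev := by
  fin_cases i
  · exact hv.conj_30
  · exact hv.conj_21
  · change star (v 2) = v 1
    rw [← hv.conj_21, star_star]
  · change star (v 3) = v 0
    rw [← hv.conj_30, star_star]

theorem IsHodgeBasis.basisChange_map_conj (hv : V.IsHodgeBasis b v)
    (X : Matrix (Fin 4) (Fin 4) ℂ) :
    basisChange v (X.map (starRingEnd ℂ)) = conjRev (basisChange v X) := by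
  apply basisChange_eq_of_mulVec
  intro j
  have h1 : X.map (starRingEnd ℂ) *ᵥ v j = star (X *ᵥ v j.rev) := by
    rw [← hv.star_apply]
    ext i
    simp [Matrix.mulVec, dotProduct]
  rw [h1, mulVec_basis, star_sum, ← Equiv.sum_comp Fin.revPerm]
  refine Finset.sum_congr rfl fun i _ => ?_
  rw [star_smul, hv.star_apply, Fin.revPerm_apply, Fin.rev_rev, conjRev_apply]
  rfl

theorem bilinC_skew (x y : Fin 4 → ℂ) : bilinC V.Q x y = -bilinC V.Q y x := by
  have h : (V.Q.map (fun q : ℚ => (q : ℂ)))ᵀ = -V.Q.map (fun q : ℚ => (q : ℂ)) := by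
    rw [← Matrix.transpose_map, V.Q_alternating]
    ext i j; simp
  rw [bilinC, bilinC, Matrix.dotProduct_mulVec, ← Matrix.mulVec_transpose, h, Matrix.neg_mulVec,
    neg_dotProduct, dotProduct_comm]

theorem bilinC_star (x y : Fin 4 → ℂ) :
    bilinC V.Q (star x) (star y) = star (bilinC V.Q x y) := by
  simp [bilinC, dotProduct, Matrix.mulVec]

theorem IsHodgeBasis.transpose_mul_mul (hb : b ∈ V.B) (hv : V.IsHodgeBasis b v) :
    (basisMatrix v)ᵀ * V.Q.map (fun q : ℚ => (q : ℂ)) * basisMatrix v = hodgeGram := by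
  have e : ∀ i j, ((basisMatrix v)ᵀ * V.Q.map (fun q : ℚ => (q : ℂ)) * basisMatrix v) i j =
      bilinC V.Q (v i) (v j) := by
    intro i j
    rw [Matrix.mul_assoc, Matrix.mul_apply]
    rfl
  have m0 := hv.mem_30.1
  have m0' := V.F_antitone b hb 2 m0
  have h00 : bilinC V.Q (v 0) (v 0) = 0 :=
    V.orthogonal b hb 3 1 rfl _ m0 _ (V.F_antitone b hb 1 m0')
  have h01 : bilinC V.Q (v 0) (v 1) = 0 := V.orthogonal b hb 2 2 rfl _ m0' _ hv.mem_21.1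
  have h02 : bilinC V.Q (v 0) (v 2) = 0 := V.orthogonal b hb 3 1 rfl _ m0 _ hv.mem_12.1
  have h11 : bilinC V.Q (v 1) (v 1) = 0 := V.orthogonal b hb 2 2 rfl _ hv.mem_21.1 _ hv.mem_21.1
  have h03 : bilinC V.Q (v 0) (v 3) = -I := by
    have := hv.norm_30
    rw [bilinC, smul_dotProduct, smul_eq_mul] at this
    change I * bilinC V.Q (v 0) (v 3) = 1 at this
    linear_combination (-I) * this + bilinC V.Q (v 0) (v 3) * I_sq
  have h12 : bilinC V.Q (v 1) (v 2) = I := by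
    have := hv.norm_21
    rw [bilinC, smul_dotProduct, smul_eq_mul] at this
    change -I * bilinC V.Q (v 1) (v 2) = 1 at this
    linear_combination I * this + bilinC V.Q (v 1) (v 2) * I_sq
  -- The bilinear relations give the entries above; as `Q` is rational, conjugation and skew
  -- symmetry give the others.
  have hs : ∀ i j : Fin 4, bilinC V.Q (v i) (v j) = star (bilinC V.Q (v i.rev) (v j.rev)) := by
    intro i j
    rw [← bilinC_star, hv.star_apply, hv.star_apply, Fin.rev_rev, Fin.rev_rev]
  have h13 : bilinC V.Q (v 1) (v 3) = 0 := by
    rw [hs]; change star (bilinC V.Q (v 2) (v 0)) = 0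
    rw [bilinC_skew, h02]; simp
  have h22 : bilinC V.Q (v 2) (v 2) = 0 := by
    rw [hs]; change star (bilinC V.Q (v 1) (v 1)) = 0
    rw [h11]; simp
  have h33 : bilinC V.Q (v 3) (v 3) = 0 := by
    rw [hs]; change star (bilinC V.Q (v 0) (v 0)) = 0
    rw [h00]; simp
  have h23 : bilinC V.Q (v 2) (v 3) = 0 := by
    rw [hs]; change star (bilinC V.Q (v 1) (v 0)) = 0
    rw [bilinC_skew, h01]; simp
  have h10 := bilinC_skew (V := V) (v 1) (v 0)
  have h20 := bilinC_skew (V := V) (v 2) (v 0)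
  have h30 := bilinC_skew (V := V) (v 3) (v 0)
  have h21 := bilinC_skew (V := V) (v 2) (v 1)
  have h31 := bilinC_skew (V := V) (v 3) (v 1)
  have h32 := bilinC_skew (V := V) (v 3) (v 2)
  ext i j
  rw [e]
  fin_cases i <;> fin_cases j <;> simp [hodgeGram, h00, h01, h02, h03, h11, h12, h13, h22, h23, h33, h10, h20, h30, h21, h31, h32]

theorem IsHodgeBasis.basisChange_isHodgeAction (hv : V.IsHodgeBasis b v) {z : ℂ}
    {g : GL (Fin 4) ℂ} (hg : V.IsHodgeAction b z g) :
    basisChange v g.val = Matrix.diagonal ![z ^ 3, z ^ 2 * star z, z * star z ^ 2, star z ^ 3] := by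
  apply basisChange_eq_of_mulVec
  intro j
  simp only [Matrix.diagonal_apply, ite_smul, zero_smul]
  rw [Finset.sum_ite_eq' Finset.univ j]
  fin_cases j
  · simpa using hg 3 0 rfl _ hv.mem_30
  · simpa using hg 2 1 rfl _ hv.mem_21
  · simpa using hg 1 2 rfl _ hv.mem_12
  · simpa using hg 0 3 rfl _ hv.mem_03

/-- `Q` pairs `H^{p,q}` only with `H^{q,p}`, and the factors there multiply to `(z * star z) ^ 3 =
1`. -/
theorem IsHodgeBasis.isHodgeAction_mem_isometryGroup (hb : b ∈ V.B) (hv : V.IsHodgeBasis b v)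
    {z : ℂ} (hz : ‖z‖ = 1) {g : GL (Fin 4) ℂ} (hg : V.IsHodgeAction b z g) :
    g ∈ isometryGroup V.Q := by
  rw [mem_isometryGroup]
  apply basisMatrix_injective v
  have hz1 : z * star z = 1 := by
    have := Complex.mul_conj' z
    rw [hz] at this
    simpa using this
  calc _ = (g.val * basisMatrix v)ᵀ * V.Q.map (fun q : ℚ => (q : ℂ)) * (g.val * basisMatrix v) := by
        rw [Matrix.transpose_mul]; simp only [Matrix.mul_assoc]
    _ = (basisChange v g.val)ᵀ * hodgeGram * basisChange v g.val := by
        rw [mul_basisMatrix, ← hv.transpose_mul_mul hb, Matrix.transpose_mul]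
        simp only [Matrix.mul_assoc]
    _ = hodgeGram := by
        rw [hv.basisChange_isHodgeAction hg, Matrix.diagonal_transpose]
        ext i j
        rw [Matrix.mul_diagonal, Matrix.diagonal_mul]
        fin_cases i <;> fin_cases j <;> simp [hodgeGram] at hz1 ⊢
        all_goals
          linear_combination I * ((z * starRingEnd ℂ z) ^ 2 + z * starRingEnd ℂ z + 1) * hz1
    _ = _ := (hv.transpose_mul_mul hb).symm

variable (V) in
theorem genericHodgeGroup_le_isometryGroup : V.genericHodgeGroup ≤ isometryGroup V.Q := by
  refine sInf_le ⟨isAlgebraicOver_isometryGroup _, fun c hc => ?_⟩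
  obtain ⟨w, hw⟩ := V.exists_isHodgeBasis hc
  exact sInf_le ⟨isAlgebraicOver_isometryGroup _, fun z hz g hg =>
    hw.isHodgeAction_mem_isometryGroup hc hz hg⟩

/-- The operator `h_b(exp (t I))` is the exponential of `t I` times the weight matrix, because `z^p
* conj z^q` becomes `exp ((p - q) t I)`. The factor `I` is removed by complex scaling. -/
theorem IsHodgeBasis.weightMatrix_mem (hb : b ∈ V.B) (hv : V.IsHodgeBasis b v) :
    (basisChange v).symm weightMatrix ∈ lieSubmodule V.isAlgebraicOver_genericHodgeGroup := by
  have h : I • (basisChange v).symm weightMatrix ∈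
      lieSubmodule V.isAlgebraicOver_genericHodgeGroup := by
    refine mem_lieAlgebraSet_of_real V.isAlgebraicOver_genericHodgeGroup fun t => ?_
    have hz : ‖Complex.exp (t * I)‖ = 1 := Complex.norm_exp_ofReal_mul_I t
    obtain ⟨g, hg, -⟩ := V.existsUnique_isHodgeAction hb hz
    suffices expGL ((t : ℂ) • I • (basisChange v).symm weightMatrix) = g by
      rw [this]
      exact V.mem_genericHodgeGroup hb hz hg
    apply Units.ext
    apply (basisChange v).injective
    have hs : star (Complex.exp (t * I)) = Complex.exp (-(t * I)) := by
      rw [Complex.star_def, ← Complex.exp_conj]; simp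
    rw [hv.basisChange_isHodgeAction hg, coe_expGL, exp_basisChange, map_smul, map_smul,
      AlgEquiv.apply_symm_apply, weightMatrix, ← Matrix.diagonal_smul, ← Matrix.diagonal_smul,
      Matrix.exp_diagonal, hs]
    congr 1
    ext i
    rw [Pi.coe_exp, ← Complex.exp_eq_exp_ℂ]
    fin_cases i <;> simp [← Complex.exp_nat_mul, ← Complex.exp_add] <;> ring_nf
  have := Submodule.smul_mem _ (-I) h
  rwa [smul_smul, neg_mul, I_mul_I, neg_neg, one_smul] at this

theorem IsHodgeBasis.exists_lieHodge_eq (hb : b ∈ V.B) (hv : V.IsHodgeBasis b v)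
    (had : AdjointGroupIsoPU11 V.genericHodgeGroup)
    (hcenter : DiscreteTopology (Subgroup.center V.genericHodgeGroup)) :
    ∃ x : ℂ, ‖x‖ ^ 2 = 4 / 3 ∧
      V.lieHodge v = (spanXY x (I * x) : Set (Matrix (Fin 4) (Fin 4) ℂ)) := by
  set hG := V.isAlgebraicOver_genericHodgeGroup
  obtain ⟨e, hreg, -⟩ := had
  set φ := e.toMonoidHom.comp (QuotientGroup.mk' (Subgroup.center V.genericHodgeGroup)) with hφ
  have hker : φ.ker = Subgroup.center V.genericHodgeGroup := by
    ext g
    rw [MonoidHom.mem_ker, hφ, MonoidHom.comp_apply, MulEquiv.coe_toMonoidHom,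
      MulEquiv.map_eq_one_iff, ← MonoidHom.mem_ker, QuotientGroup.ker_mk']
  have hsurj : Function.Surjective φ :=
    e.surjective.comp (QuotientGroup.mk'_surjective _)
  set W := (lieSubmodule hG).map (basisChange v).toLinearMap
  have memW : ∀ X, basisChange v X ∈ W ↔ X ∈ lieSubmodule hG := by
    intro X
    constructor
    · rintro ⟨Y, hY, h⟩
      rwa [← (basisChange v).injective h]
    · intro h
      exact ⟨X, h, rfl⟩
  have exW : ∀ M ∈ W, ∃ X ∈ lieSubmodule hG, basisChange v X = M := fun M hM => hM
  have hdim : Module.finrank ℂ W ≤ 3 :=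
    (Submodule.finrank_map_le _ _).trans (finrank_lieSubmodule_le hG hcenter hker hreg)
  have hw := hv.weightMatrix_mem hb
  have hH : weightMatrix ∈ W := by
    have := (memW _).2 hw
    rwa [AlgEquiv.apply_symm_apply] at this
  have hbr : ∀ X ∈ W, ∀ Y ∈ W, X * Y - Y * X ∈ W := by
    intro X hX Y hY
    obtain ⟨X, hX', rfl⟩ := exW X hX
    obtain ⟨Y, hY', rfl⟩ := exW Y hY
    rw [← map_mul, ← map_mul, ← map_sub, memW]
    exact bracket_mem_lieSubmodule hG hX' hY'
  have hconj : ∀ X ∈ W, conjRev X ∈ W := by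
    intro X hX
    obtain ⟨X, hX', rfl⟩ := exW X hX
    rw [← hv.basisChange_map_conj, memW]
    exact map_conj_mem_lieSubmodule hG hX'
  have hsp : ∀ X ∈ W, Xᵀ * hodgeGram + hodgeGram * X = 0 := by
    intro X hX
    obtain ⟨X, hX', rfl⟩ := exW X hX
    have h1 := transpose_mul_add_mul_eq_zero (Q := V.Q) fun z =>
      V.genericHodgeGroup_le_isometryGroup (hX' z)
    calc _ = (basisMatrix v * basisChange v X)ᵀ * V.Q.map (fun q : ℚ => (q : ℂ)) * basisMatrix v +
          (basisMatrix v)ᵀ * V.Q.map (fun q : ℚ => (q : ℂ)) * (basisMatrix v * basisChange v X) := by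
          rw [← hv.transpose_mul_mul hb, Matrix.transpose_mul]; simp only [Matrix.mul_assoc]
      _ = (basisMatrix v)ᵀ * (Xᵀ * V.Q.map (fun q : ℚ => (q : ℂ)) +
          V.Q.map (fun q : ℚ => (q : ℂ)) * X) * basisMatrix v := by
          rw [← mul_basisMatrix, Matrix.transpose_mul, Matrix.mul_add, Matrix.add_mul]
          simp only [Matrix.mul_assoc]
      _ = 0 := by rw [h1]; simp
  -- Conjugates of the weight matrix under the group stay in the Lie algebra. If all of `W` were
  -- diagonal they would commute with it, forcing it to be zero.
  obtain ⟨X, hX, i, j, hij, hne⟩ : ∃ X ∈ W, ∃ i j, i ≠ j ∧ X i j ≠ 0 := by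
    by_contra! hdiag
    have h0 := eq_zero_of_commute_conj hG hcenter hker hsurj hw fun g hg => by
      have hmem := conj_mem_lieSubmodule hG hg hw
      generalize g.val * (basisChange v).symm weightMatrix * (g⁻¹).val = C at hmem ⊢
      apply (basisChange v).injective
      rw [map_mul, map_mul, AlgEquiv.apply_symm_apply]
      ext i j
      rw [weightMatrix, Matrix.diagonal_mul, Matrix.mul_diagonal]
      by_cases hij : i = j
      · rw [hij, mul_comm]
      · rw [hdiag _ ((memW C).2 hmem) i j hij]; simp
    have h1 : weightMatrix = 0 := by simpa using h0
    simpa [weightMatrix] using congrFun (congrFun h1 0) 0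
  obtain ⟨E, hE, hE0, m, hm, hEm⟩ := exists_positive_weight hH hbr hconj hX hij hne
  obtain ⟨x, hx, hnorm⟩ := exists_raisingMatrix_mem hdim hH hbr hconj hsp hE hE0 hm hEm
  refine ⟨x, hnorm, Set.ext fun M => ?_⟩
  rw [SetLike.mem_coe, real_points_eq_spanXY hdim hH hconj hx]
  constructor
  · rintro ⟨X, hX, rfl⟩
    obtain ⟨h1, h2⟩ := (mem_lieAlgebraReal_iff hG).1 hX
    refine ⟨(memW X).2 h1, ?_⟩
    change conjRev (basisChange v X) = basisChange v X
    rw [← hv.basisChange_map_conj, h2]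
  · rintro ⟨hM, hr⟩
    obtain ⟨X, hX', rfl⟩ := exW M hM
    refine ⟨X, (mem_lieAlgebraReal_iff hG).2 ⟨hX', ?_⟩, rfl⟩
    apply (basisChange v).injective
    rw [hv.basisChange_map_conj, hr]

end PolarizedVHS

end

/-! ### Conclusion -/

theorem mainTheorem7 (V : PolarizedVHS) (b : ℂ) (hb : b ∈ V.B)
    (v : Module.Basis (Fin 4) ℂ (Fin 4 → ℂ)) (hv : V.IsHodgeBasis b v)
    (had : AdjointGroupIsoPU11 V.genericHodgeGroup)
    (hcenter : DiscreteTopology (Subgroup.center V.genericHodgeGroup)) :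
    (∃ x y : ℂ, V.lieHodge v = (spanXY x y : Set (Matrix (Fin 4) (Fin 4) ℂ))) ∧
    ∀ x y : ℂ, V.lieHodge v = (spanXY x y : Set (Matrix (Fin 4) (Fin 4) ℂ)) →
      y = I * x ∧ ‖x‖ = 2 / Real.sqrt 3 := by
  obtain ⟨x₀, hx₀, h⟩ := hv.exists_lieHodge_eq hb had hcenter
  refine ⟨⟨x₀, I * x₀, h⟩, fun x y hxy => ?_⟩
  obtain ⟨rfl, rfl⟩ := eq_of_spanXY_eq (h.symm.trans hxy)
  refine ⟨rfl, ?_⟩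
  rw [← Real.sqrt_sq (norm_nonneg x), hx₀, Real.sqrt_div (by norm_num)]
  congr 1
  rw [show (4 : ℝ) = 2 ^ 2 by norm_num, Real.sqrt_sq (by norm_num)]
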